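/- Let $n\ge 2$. Let $K_n=\{0,\dots,n-1\}^{\mathbb N}$ be the Cantor set of ends of the infinite rooted $n$-ary tree $\mathcal T_n$ (with the product topology); for a vertex $a$ of $\mathcal T_n$, i.e. a finite word in $\{0,\dots,n-1\}$, let $K_a\subset K_n$ be the set of infinite words with prefix $a$. Thompson's group $V_n\subset \mathrm{Homeo}(K_n)$ is the group of homeomorphisms $g$ described by a tree pair diagram $(A,B,\sigma)$: $A$ and $B$ are finite rooted subtrees of $\mathcal T_n$ containing its root, in which every vertex has either $0$ or $n$ children, $\sigma$ is a bijection from the endpoints (leaves) of $A$ to the endpoints of $B$, and $g(ax)=\sigma(a)x$ for every endpoint $a$ of $A$ and every $x\in K_n$ (so $g$ maps $K_a$ onto $K_{\sigma(a)}$ by changing the prefix). **Theorem.** For any finitely generated subgroup $\Gamma\subset V_n$, either the action of $\Gamma$ on $K_n$ has a finite orbit, i.e. there is $p\in K_n$ such that $\Gamma(p)=\{g(p) : g\in\Gamma\}$ is finite, or $\Gamma$ contains a free subgroup on two generators. (The two alternatives need not exclude each other.) -/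

import Mathlib

/-- The Cantor set `K_n`: the space of ends of the infinite rooted `n`-ary tree, whose vertices are
the finite words in `Fin n`. An end is an infinite word; the topology is the product topology. -/
abbrev CantorK (n : ℕ) : Type := ℕ → Fin n

/-- The end `w x` obtained by writing the finite word `w` in front of the infinite word `x`. The
elementary interval below the vertex `w` is the range of `prepend w`. -/
def prepend {n : ℕ} : List (Fin n) → CantorK n → CantorK n
  | [], x => x
  | i :: w, x => fun k => Nat.casesOn k i (fun m => prepend w x m)

/-- Finite `n`-ary rooted trees: every vertex has either no child or exactly `n` children, indexed
by `Fin n`. They are the finite full subtrees, containing the root, of the infinite `n`-ary tree. -/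
inductive NaryTree (n : ℕ) : Type
  | leaf : NaryTree n
  | node (child : Fin n → NaryTree n) : NaryTree n

/-- The endpoints (leaves) of a finite `n`-ary rooted tree, as vertices of the infinite tree. -/
def NaryTree.endpoints {n : ℕ} : NaryTree n → Set (List (Fin n))
  | .leaf => {[]}
  | .node child => {w | ∃ i, ∃ v ∈ (child i).endpoints, w = i :: v}

/-- The homeomorphism `g` of `K_n` is described by the tree pair diagram `(A, B, σ)`: for every
endpoint `a` of `A`, it maps the interval below `a` onto the interval below `σ a` by replacing the
prefix `a` with `σ a`. -/
def DescribedBy {n : ℕ} (g : CantorK n ≃ₜ CantorK n) (A B : NaryTree n)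
    (σ : A.endpoints ≃ B.endpoints) : Prop :=
  ∀ (a : A.endpoints) (x : CantorK n), g (prepend a.1 x) = prepend (σ a).1 x

theorem prepend_append {n : ℕ} (v w : List (Fin n)) (x : CantorK n) :
    prepend (v ++ w) x = prepend v (prepend w x) := by
  induction v with
  | nil => rfl
  | cons i v ih => funext k; cases k with
    | zero => rfl
    | succ k => exact congrFun ih k

theorem prepend_cons_inj {n : ℕ} {i j : Fin n} {v w : List (Fin n)} {x y : CantorK n} :
    prepend (i :: v) x = prepend (j :: w) y ↔ i = j ∧ prepend v x = prepend w y := by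
  constructor
  · intro h
    exact ⟨congrFun h 0, funext fun k => congrFun h (k + 1)⟩
  · rintro ⟨rfl, h⟩
    funext k
    cases k with
    | zero => rfl
    | succ k => exact congrFun h k

theorem exists_eq_prepend_singleton {n : ℕ} (x : CantorK n) :
    x = prepend [x 0] (fun k => x (k + 1)) := by
  funext k
  cases k <;> rfl

/-- The intervals below the endpoints of a tree partition `K_n`. -/
theorem NaryTree.existsUnique_endpoint {n : ℕ} (A : NaryTree n) (x : CantorK n) :
    ∃! a, a ∈ A.endpoints ∧ ∃ y, x = prepend a y := by
  induction A generalizing x with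
  | leaf => exact ⟨[], ⟨rfl, x, rfl⟩, fun a h => h.1⟩
  | node child ih =>
    obtain ⟨a, ⟨ha, y, hy⟩, hu⟩ := ih (x 0) (fun k => x (k + 1))
    refine ⟨x 0 :: a, ⟨⟨x 0, a, ha, rfl⟩, y, ?_⟩, ?_⟩
    · rw [exists_eq_prepend_singleton x, hy]
      exact (prepend_append [x 0] a y).symm
    · rintro b ⟨⟨i, v, hv, rfl⟩, z, hz⟩
      have h0 : x 0 = i := congrFun hz 0
      subst h0
      rw [hu v ⟨hv, z, funext fun k => congrFun hz (k + 1)⟩]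

theorem NaryTree.endpoints_finite {n : ℕ} (A : NaryTree n) : A.endpoints.Finite := by
  induction A with
  | leaf => exact Set.finite_singleton _
  | node child ih =>
    refine (Set.finite_iUnion fun i => (ih i).image (List.cons i)).subset ?_
    rintro w ⟨i, v, hv, rfl⟩
    exact Set.mem_iUnion.2 ⟨i, v, hv, rfl⟩

/-- Every finite partition of `K_n` into elementary intervals comes from a tree. -/
theorem NaryTree.exists_of_partition {n : ℕ} (hn : 0 < n) (L : ℕ) (S : Set (List (Fin n)))
    (hL : ∀ w ∈ S, w.length ≤ L) (hS : ∀ x : CantorK n, ∃! a, a ∈ S ∧ ∃ y, x = prepend a y) :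
    ∃ T : NaryTree n, T.endpoints = S := by
  induction L generalizing S with
  | zero =>
    have h0 : ∀ w ∈ S, w = [] := fun w hw => List.length_eq_zero_iff.1 (Nat.le_zero.1 (hL w hw))
    obtain ⟨a, ⟨ha, -⟩, -⟩ := hS (fun _ => ⟨0, hn⟩)
    refine ⟨.leaf, Set.ext fun w => ⟨?_, fun hw => h0 w hw⟩⟩
    rintro (rfl : w = [])
    rwa [← h0 a ha]
  | succ L ih =>
    by_cases hnil : [] ∈ S
    · refine ⟨.leaf, Set.ext fun w => ⟨?_, fun hw => ?_⟩⟩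
      · rintro (rfl : w = [])
        exact hnil
      · exact (hS (prepend w fun _ => ⟨0, hn⟩)).unique ⟨hw, _, rfl⟩ ⟨hnil, _, rfl⟩
    · have key : ∀ i : Fin n, ∃ T : NaryTree n, T.endpoints = {w | i :: w ∈ S} := by
        intro i
        refine ih _ (fun w hw => by simpa using hL _ hw) fun x => ?_
        obtain ⟨a, ⟨ha, y, hy⟩, hu⟩ := hS (prepend [i] x)
        cases a with
        | nil => exact absurd ha hnil
        | cons j a =>
          obtain ⟨rfl, hxy⟩ := prepend_cons_inj.1 hy
          refine ⟨a, ⟨ha, y, hxy⟩, ?_⟩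
          rintro b ⟨hb, z, hz⟩
          have := hu (i :: b) ⟨hb, z, prepend_cons_inj.2 ⟨rfl, hz⟩⟩
          exact (List.cons.inj this).2
      choose T hT using key
      refine ⟨.node T, Set.ext fun w => ⟨?_, fun hw => ?_⟩⟩
      · rintro ⟨i, v, hv, rfl⟩
        rw [hT i] at hv
        exact hv
      · cases w with
        | nil => exact absurd hw hnil
        | cons i w => exact ⟨i, w, by rw [hT i]; exact hw, rfl⟩

theorem describedBy_one {n : ℕ} :
    DescribedBy (1 : CantorK n ≃ₜ CantorK n) .leaf .leaf (Equiv.refl _) :=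
  fun _ _ => rfl

theorem DescribedBy.inv {n : ℕ} {g : CantorK n ≃ₜ CantorK n} {A B : NaryTree n}
    {σ : A.endpoints ≃ B.endpoints} (h : DescribedBy g A B σ) :
    DescribedBy g⁻¹ B A σ.symm := by
  intro b x
  have := h (σ.symm b) x
  rw [Equiv.apply_symm_apply] at this
  rw [← this]
  exact g.symm_apply_apply _

/-- A homeomorphism that replaces prefixes along the endpoints of a tree is given by a tree pair. -/
theorem exists_describedBy {n : ℕ} (hn : 0 < n) (g : CantorK n ≃ₜ CantorK n) (A : NaryTree n)
    (h : ∀ a ∈ A.endpoints, ∃ b, ∀ x, g (prepend a x) = prepend b x) :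
    ∃ (B : NaryTree n) (σ : A.endpoints ≃ B.endpoints), DescribedBy g A B σ := by
  choose! f hf using h
  have hfin : (f '' A.endpoints).Finite := A.endpoints_finite.image f
  have hinj : Set.InjOn f A.endpoints := by
    intro a ha b hb hab
    have e : prepend a (fun _ => ⟨0, hn⟩) = prepend b (fun _ => ⟨0, hn⟩) :=
      g.injective (by rw [hf a ha, hf b hb, hab])
    exact (A.existsUnique_endpoint _).unique ⟨ha, _, rfl⟩ ⟨hb, _, e⟩
  obtain ⟨L, hL⟩ := (hfin.image List.length).bddAbove
  obtain ⟨B, hB⟩ := NaryTree.exists_of_partition hn L (f '' A.endpoints)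
    (fun w hw => hL ⟨w, hw, rfl⟩) (by
      intro x
      obtain ⟨a, ⟨ha, y, hy⟩, hu⟩ := A.existsUnique_endpoint (g.symm x)
      refine ⟨f a, ⟨⟨a, ha, rfl⟩, y, ?_⟩, ?_⟩
      · rw [← hf a ha, ← hy, g.apply_symm_apply]
      · rintro b ⟨⟨c, hc, rfl⟩, z, hz⟩
        rw [hu c ⟨hc, z, by rw [hz, ← hf c hc, g.symm_apply_apply]⟩])
  refine ⟨B, (hinj.bijOn_image.equiv f).trans (Equiv.setCongr hB.symm), ?_⟩
  intro a x
  exact hf a.1 a.2 x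

/-- Every long enough word starts with an endpoint of a given tree. -/
theorem NaryTree.exists_prefix {n : ℕ} (A : NaryTree n) :
    ∃ L : ℕ, ∀ w : List (Fin n), L ≤ w.length → ∃ a ∈ A.endpoints, ∃ u, w = a ++ u := by
  induction A with
  | leaf => exact ⟨0, fun w _ => ⟨[], rfl, w, rfl⟩⟩
  | node child ih =>
    choose L hL using ih
    refine ⟨(∑ i, L i) + 1, fun w hw => ?_⟩
    cases w with
    | nil => simp at hw
    | cons i w =>
      have h1 : L i ≤ ∑ i, L i := Finset.single_le_sum (fun _ _ => Nat.zero_le _) (Finset.mem_univ i)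
      have h2 : (∑ i, L i) ≤ w.length := by simpa using hw
      obtain ⟨a, ha, u, rfl⟩ := hL i w (h1.trans h2)
      exact ⟨i :: a, ⟨i, a, ha, rfl⟩, u, rfl⟩

theorem NaryTree.exists_length_eq {n : ℕ} (N : ℕ) :
    ∃ T : NaryTree n, ∀ w ∈ T.endpoints, w.length = N := by
  induction N with
  | zero => exact ⟨.leaf, fun w hw => by rw [show w = [] from hw]; rfl⟩
  | succ N ih =>
    obtain ⟨T, hT⟩ := ih
    refine ⟨.node fun _ => T, ?_⟩
    rintro w ⟨i, v, hv, rfl⟩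
    simp [hT v hv]

theorem DescribedBy.mul {n : ℕ} (hn : 0 < n) {g h : CantorK n ≃ₜ CantorK n}
    {A B C D : NaryTree n} {σ : A.endpoints ≃ B.endpoints} {τ : C.endpoints ≃ D.endpoints}
    (hg : DescribedBy g A B σ) (hh : DescribedBy h C D τ) :
    ∃ (E F : NaryTree n) (ρ : E.endpoints ≃ F.endpoints), DescribedBy (g * h) E F ρ := by
  obtain ⟨L, hL⟩ := A.exists_prefix
  obtain ⟨M, hM⟩ := C.exists_prefix
  obtain ⟨K, hK⟩ := (C.endpoints_finite.image List.length).bddAbove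
  obtain ⟨T, hT⟩ := NaryTree.exists_length_eq (n := n) (M + (K + L))
  refine ⟨T, exists_describedBy hn _ T fun w hw => ?_⟩
  have hw' := hT w hw
  obtain ⟨c, hc, u, rfl⟩ := hM w (by omega)
  have hcK : c.length ≤ K := hK ⟨c, hc, rfl⟩
  rw [List.length_append] at hw'
  obtain ⟨a, ha, v, hv⟩ := hL ((τ ⟨c, hc⟩).1 ++ u) (by rw [List.length_append]; omega)
  refine ⟨(σ ⟨a, ha⟩).1 ++ v, fun x => ?_⟩
  have e : h (prepend (c ++ u) x) = prepend a (prepend v x) := by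
    rw [prepend_append, hh ⟨c, hc⟩, ← prepend_append, hv, prepend_append]
  rw [Homeomorph.mul_apply, e, hg ⟨a, ha⟩, prepend_append]

/-- Thompson's group `V_n`: the homeomorphisms of `K_n` that have a tree pair diagram. -/
def ThompsonV (n : ℕ) : Subgroup (CantorK n ≃ₜ CantorK n) where
  carrier := {g | ∃ (A B : NaryTree n) (σ : A.endpoints ≃ B.endpoints), DescribedBy g A B σ}
  one_mem' := ⟨_, _, _, describedBy_one⟩
  inv_mem' := by
    rintro g ⟨A, B, σ, h⟩
    exact ⟨B, A, σ.symm, h.inv⟩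
  mul_mem' := by
    rintro g h ⟨A, B, σ, hg⟩ ⟨C, D, τ, hh⟩
    rcases Nat.eq_zero_or_pos n with rfl | hn
    · exact ⟨.leaf, .leaf, Equiv.refl _, fun _ x => (x 0).elim0⟩
    · exact hg.mul hn hh

/-! The dichotomy is whether Γ preserves a mean, i.e. a finitely additive probability, on `K_n`.

Suppose that it does. For each α > 0 there are finitely many ends all of whose intervals have mass
at least α, and Γ permutes them. Start from an end `y` with intervals of positive mass. Either such
a heavy end exists, or every element of Γ acts on one interval around `y` by a prefix change with
only finitely many image intervals; both give a finite orbit (`InvariantMean.exists_finite_orbit`).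

Suppose that it does not. By ℓ² duality in the style of Kesten and Hulanicki, the averaging operator
of a symmetric generating set has a spectral gap (`exists_spectral_gap`), so a random word of length
k carries one given prefix map to another with probability at most ρ^k, ρ < 1. There are finitely
many shallow intervals, so deep intervals tend to be contracted. Iterating, a random word sends each
deep interval into one of d tiny intervals, except with probability η, where d grows linearly while
η decays exponentially (`exists_captures`). Once dη is small, four independent random words contract
each other's target sets, and ping-pong yields a free group (`exists_free_of_captures`). -/

/-- Square-summable real functions on a set. -/
abbrev EllTwo (Ω : Type*) : Type _ := lp (fun _ : Ω => ℝ) 2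

/-- A finitely additive probability on all subsets, invariant under a group action. -/
structure InvariantMean (G X : Type*) [Group G] [MulAction G X] where
  mass : Set X → ℝ
  mass_nonneg : ∀ A, 0 ≤ mass A
  mass_univ : mass Set.univ = 1
  mass_union : ∀ A B, Disjoint A B → mass (A ∪ B) = mass A + mass B
  mass_preimage : ∀ (g : G) (A : Set X), mass ((fun x => g • x) ⁻¹' A) = mass A

/-! ### The permutation representation on ℓ². -/

namespace EllTwo

variable {Ω : Type*}

theorem mem_iff {f : Ω → ℝ} : Memℓp f 2 ↔ Summable fun ω => f ω ^ 2 := by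
  rw [memℓp_gen_iff (by norm_num)]
  simp

theorem summable_sq (f : EllTwo Ω) : Summable fun ω => f ω ^ 2 :=
  mem_iff.1 (lp.memℓp f)

theorem norm_sq (f : EllTwo Ω) : ‖f‖ ^ 2 = ∑' ω, f ω ^ 2 := by
  have := lp.norm_rpow_eq_tsum (p := 2) (by norm_num) f
  simpa using this

/-- Multiplication by the indicator function of a set. -/
noncomputable def restrict (A : Set Ω) (f : EllTwo Ω) : EllTwo Ω :=
  ⟨A.indicator f, by
    change Memℓp (A.indicator f) 2
    refine mem_iff.2 ?_
    have : (fun ω => A.indicator f ω ^ 2) = A.indicator fun ω => f ω ^ 2 := by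
      funext ω
      by_cases h : ω ∈ A <;> simp [h]
    rw [this]
    exact (summable_sq f).indicator A⟩

theorem restrict_apply (A : Set Ω) (f : EllTwo Ω) (ω : Ω) :
    restrict A f ω = A.indicator f ω := rfl

theorem restrict_sq_apply (A : Set Ω) (f : EllTwo Ω) (ω : Ω) :
    restrict A f ω ^ 2 = A.indicator (fun ω => f ω ^ 2) ω := by
  rw [restrict_apply]
  by_cases h : ω ∈ A <;> simp [h]

theorem restrict_sub (A : Set Ω) (f g : EllTwo Ω) :
    restrict A (f - g) = restrict A f - restrict A g := by
  ext ω
  exact congrFun (Set.indicator_sub A f g) ω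

theorem restrict_univ (f : EllTwo Ω) : restrict Set.univ f = f := by
  ext ω
  simp [restrict_apply]

theorem norm_restrict_le (A : Set Ω) (f : EllTwo Ω) : ‖restrict A f‖ ≤ ‖f‖ := by
  refine le_of_sq_le_sq ?_ (norm_nonneg _)
  rw [norm_sq, norm_sq]
  refine (summable_sq _).tsum_le_tsum (fun ω => ?_) (summable_sq f)
  rw [restrict_sq_apply]
  exact Set.indicator_le_self' (fun _ _ => sq_nonneg _) ω

theorem norm_restrict_union_sq {A B : Set Ω} (h : Disjoint A B) (f : EllTwo Ω) :
    ‖restrict (A ∪ B) f‖ ^ 2 = ‖restrict A f‖ ^ 2 + ‖restrict B f‖ ^ 2 := by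
  rw [norm_sq, norm_sq, norm_sq, ← (summable_sq _).tsum_add (summable_sq _)]
  refine tsum_congr fun ω => ?_
  simp only [restrict_sq_apply, Set.indicator_union_of_disjoint h]

variable {G : Type*} [Group G] [MulAction G Ω]

/-- The permutation representation on square-summable functions. -/
def translate (g : G) : EllTwo Ω →ₗ[ℝ] EllTwo Ω where
  toFun f := ⟨fun ω => f (g⁻¹ • ω), by
    change Memℓp (fun ω => f (g⁻¹ • ω)) 2
    exact mem_iff.2 ((summable_sq f).comp_injective (MulAction.injective g⁻¹))⟩
  map_add' _ _ := rfl
  map_smul' _ _ := rfl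

theorem translate_apply (g : G) (f : EllTwo Ω) (ω : Ω) : translate g f ω = f (g⁻¹ • ω) := rfl

theorem translate_one (f : EllTwo Ω) : translate (1 : G) f = f := by
  ext ω
  simp [translate_apply]

theorem norm_translate (g : G) (f : EllTwo Ω) : ‖translate g f‖ = ‖f‖ := by
  refine (sq_eq_sq₀ (norm_nonneg _) (norm_nonneg _)).1 ?_
  rw [norm_sq, norm_sq]
  exact (MulAction.toPerm g⁻¹).tsum_eq fun ω => f ω ^ 2

theorem restrict_translate (g : G) (A : Set Ω) (f : EllTwo Ω) :
    restrict A (translate g f) = translate g (restrict ((fun x => g • x) ⁻¹' A) f) := by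
  ext ω
  by_cases h : ω ∈ A <;> simp [restrict_apply, translate_apply, Set.indicator, h]

/-- The averaging operator of a finite family of group elements. -/
noncomputable def average {ι : Type*} [Fintype ι] (S : ι → G) : EllTwo Ω →ₗ[ℝ] EllTwo Ω :=
  (Fintype.card ι : ℝ)⁻¹ • ∑ i, translate (S i)

theorem average_apply {ι : Type*} [Fintype ι] (S : ι → G) (f : EllTwo Ω) :
    average S f = (Fintype.card ι : ℝ)⁻¹ • ∑ i, translate (S i) f := by
  simp [average]

end EllTwo

/-! ### Invariant means and the spectral gap. -/

/-- If the average of unit vectors is almost a unit vector, then they are close to each other. -/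
theorem norm_sub_sq_le_of_norm_sum {E ι : Type*} [NormedAddCommGroup E] [InnerProductSpace ℝ E]
    [Fintype ι] (v : ι → E) (hv : ∀ i, ‖v i‖ = 1) {ε : ℝ} (hε : ε ≤ 2)
    (h : (Fintype.card ι : ℝ) - ε ≤ ‖∑ i, v i‖) (i j : ι) : ‖v i - v j‖ ^ 2 ≤ 4 * ε := by
  classical
  rcases eq_or_ne i j with rfl | hij
  · have : ‖∑ i, v i‖ ≤ Fintype.card ι :=
      (norm_sum_le _ _).trans (by simp [hv])
    simp
    linarith
  have h1 : ∑ k, v k = (v i + v j) + ∑ k ∈ (Finset.univ.erase i).erase j, v k := by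
    rw [add_assoc, Finset.add_sum_erase _ _ (by simp [hij.symm]),
      Finset.add_sum_erase _ _ (Finset.mem_univ i)]
  have h2 : ‖∑ k ∈ (Finset.univ.erase i).erase j, v k‖ ≤ (Fintype.card ι : ℝ) - 2 := by
    refine (norm_sum_le _ _).trans ?_
    have hc : ((Finset.univ.erase i).erase j).card + 1 + 1 = Fintype.card ι := by
      rw [Finset.card_erase_add_one (by simp [hij.symm]),
        Finset.card_erase_add_one (Finset.mem_univ i), Finset.card_univ]
    simp only [hv, Finset.sum_const, nsmul_eq_mul, mul_one]
    rw [← hc]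
    push_cast
    linarith
  have h3 : 2 - ε ≤ ‖v i + v j‖ := by
    have := norm_add_le (v i + v j) (∑ k ∈ (Finset.univ.erase i).erase j, v k)
    rw [← h1] at this
    linarith
  -- The squared difference is 4 minus the squared norm of the sum, hence at most 4 - (2 - ε)² ≤ 4ε.
  have h4 := parallelogram_law_with_norm ℝ (v i) (v j)
  rw [hv, hv] at h4
  nlinarith [norm_nonneg (v i + v j)]

/-- The limit of a real sequence with values in the unit interval along an ultrafilter. -/
theorem exists_tendsto_ultrafilter_unitInterval (U : Ultrafilter ℕ) (u : ℕ → ℝ)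
    (hu : ∀ j, u j ∈ Set.Icc (0 : ℝ) 1) : ∃ a, Filter.Tendsto u U (nhds a) := by
  obtain ⟨a, -, ha⟩ := isCompact_Icc.ultrafilter_le_nhds (U.map u)
    (Filter.le_principal_iff.2 (Filter.mem_map.2 (Filter.univ_mem' hu)))
  exact ⟨a, ha⟩

open EllTwo in
/-- Almost invariant unit vectors in the permutation representation give an invariant mean. -/
theorem exists_invariantMean_of_almost_invariant {G Ω ι : Type*} [Group G] [MulAction G Ω]
    (S : ι → G) (hS : Subgroup.closure (Set.range S) = ⊤) (f : ℕ → EllTwo Ω)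
    (hf : ∀ j, ‖f j‖ = 1)
    (h : ∀ i, Filter.Tendsto (fun j => ‖translate (S i) (f j) - f j‖) Filter.atTop (nhds 0)) :
    Nonempty (InvariantMean G Ω) := by
  let U : Ultrafilter ℕ := Filter.hyperfilter ℕ
  have hU : (U : Filter ℕ) ≤ Filter.atTop := by
    rw [← Nat.cofinite_eq_atTop]
    exact Filter.hyperfilter_le_cofinite
  have hle : ∀ A j, ‖restrict A (f j)‖ ≤ 1 := fun A j => hf j ▸ norm_restrict_le A (f j)
  -- The squares of the `f j` are probability densities; the mean of `A` is the ultrafilter limit of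
  -- the mass they give to `A`.
  have hex : ∀ A : Set Ω, ∃ a, Filter.Tendsto (fun j => ‖restrict A (f j)‖ ^ 2) U (nhds a) :=
    fun A => exists_tendsto_ultrafilter_unitInterval U _ fun j =>
      ⟨sq_nonneg _, pow_le_one₀ (norm_nonneg _) (hle A j)⟩
  choose m hm using hex
  have hgen : ∀ i A, m ((fun x => S i • x) ⁻¹' A) = m A := by
    intro i A
    have h1 : ∀ j, |‖restrict A (f j)‖ ^ 2 - ‖restrict ((fun x => S i • x) ⁻¹' A) (f j)‖ ^ 2| ≤
        2 * ‖translate (S i) (f j) - f j‖ := by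
      intro j
      have e : ‖restrict ((fun x => S i • x) ⁻¹' A) (f j)‖ =
          ‖restrict A (translate (S i) (f j))‖ := by
        rw [restrict_translate, norm_translate]
      have e1 : |‖restrict A (f j)‖ - ‖restrict ((fun x => S i • x) ⁻¹' A) (f j)‖| ≤
          ‖translate (S i) (f j) - f j‖ := by
        rw [e, abs_sub_comm]
        refine (abs_norm_sub_norm_le _ _).trans ?_
        rw [← restrict_sub]
        exact norm_restrict_le _ _
      rw [sq_sub_sq, abs_mul]
      refine mul_le_mul ?_ e1 (abs_nonneg _) (by norm_num)
      rw [abs_of_nonneg (by positivity)]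
      linarith [hle A j, hle ((fun x => S i • x) ⁻¹' A) j]
    have h2 := (hm A).sub (hm ((fun x => S i • x) ⁻¹' A))
    have h3 : Filter.Tendsto (fun j => ‖restrict A (f j)‖ ^ 2 -
        ‖restrict ((fun x => S i • x) ⁻¹' A) (f j)‖ ^ 2) U (nhds 0) := by
      refine squeeze_zero_norm h1 ?_
      simpa using ((h i).mono_left hU).const_mul 2
    linarith [tendsto_nhds_unique h2 h3]
  have hinv : ∀ g : G, ∀ A, m ((fun x => g • x) ⁻¹' A) = m A := by
    intro g
    have hg : g ∈ Subgroup.closure (Set.range S) := hS ▸ Subgroup.mem_top g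
    induction hg using Subgroup.closure_induction with
    | mem g hg =>
      obtain ⟨i, rfl⟩ := hg
      exact hgen i
    | one => intro A; simp
    | mul g k _ _ hg hk =>
      intro A
      rw [← hg A, ← hk ((fun x => g • x) ⁻¹' A)]
      simp only [Set.preimage_preimage, mul_smul]
    | inv g _ hg =>
      intro A
      rw [← hg]
      simp [Set.preimage_preimage]
  refine ⟨⟨m, fun A => ge_of_tendsto (hm A) (.of_forall fun j => sq_nonneg _), ?_, ?_, hinv⟩⟩
  · refine tendsto_nhds_unique (hm Set.univ) ?_
    simp [restrict_univ, hf]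
  · intro A B hAB
    refine tendsto_nhds_unique (hm (A ∪ B)) ?_
    simp only [norm_restrict_union_sq hAB]
    exact (hm A).add (hm B)

open EllTwo in
/-- If no mean is invariant, the averaging operator has a spectral gap. -/
theorem exists_spectral_gap {G Ω ι : Type*} [Group G] [MulAction G Ω] [Fintype ι]
    (S : ι → G) (hS : Subgroup.closure (Set.range S) = ⊤) (i₀ : ι) (h1 : S i₀ = 1)
    (h : ¬ Nonempty (InvariantMean G Ω)) :
    ∃ ρ : ℝ, 0 ≤ ρ ∧ ρ < 1 ∧ ∀ f : EllTwo Ω, ‖average S f‖ ≤ ρ * ‖f‖ := by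
  by_contra! hno
  refine h ?_
  have hm : (0 : ℝ) < Fintype.card ι := Nat.cast_pos.2 (Fintype.card_pos_iff.2 ⟨i₀⟩)
  -- The second alternative covers the small `j`, for which the estimate on unit vectors does not
  -- apply; it fails for all large `j`.
  have key : ∀ j : ℕ, ∃ f : EllTwo Ω, ‖f‖ = 1 ∧ ∀ i, ‖translate (S i) f - f‖ ^ 2 ≤
      4 * (Fintype.card ι * (1 / ((j : ℝ) + 1))) ∨ 2 < Fintype.card ι * (1 / ((j : ℝ) + 1)) := by
    intro j
    obtain ⟨f, hf⟩ := hno (1 - 1 / ((j : ℝ) + 1))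
      (by
        rw [sub_nonneg, div_le_one (by positivity)]
        linarith [(Nat.cast_nonneg j : (0 : ℝ) ≤ j)])
      (by
        have : (0 : ℝ) < 1 / ((j : ℝ) + 1) := by positivity
        linarith)
    have hf0 : 0 < ‖f‖ := by
      rw [norm_pos_iff]
      rintro rfl
      simp at hf
    refine ⟨‖f‖⁻¹ • f, by rw [norm_smul, norm_inv, norm_norm, inv_mul_cancel₀ hf0.ne'], fun i => ?_⟩
    by_cases hε : (Fintype.card ι * (1 / ((j : ℝ) + 1)) : ℝ) ≤ 2
    · left
      have hav : 1 - 1 / ((j : ℝ) + 1) ≤ ‖average S (‖f‖⁻¹ • f)‖ := by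
        rw [map_smul, norm_smul, norm_inv, norm_norm, ← div_eq_inv_mul, le_div_iff₀ hf0]
        exact hf.le
      -- Comparison with the index `i₀`, where `S i₀ = 1`, turns closeness of the translates to each
      -- other into almost invariance.
      have := norm_sub_sq_le_of_norm_sum (fun i => translate (S i) (‖f‖⁻¹ • f))
        (fun i => by rw [norm_translate, norm_smul, norm_inv, norm_norm, inv_mul_cancel₀ hf0.ne'])
        hε (by
          rw [average_apply, norm_smul, norm_inv, RCLike.norm_natCast, ← div_eq_inv_mul,
            le_div_iff₀ hm] at hav
          linarith) i i₀
      rwa [h1, translate_one] at this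
    · right
      linarith
  choose f hf hfi using key
  refine exists_invariantMean_of_almost_invariant S hS f hf fun i => ?_
  have hlim : Filter.Tendsto (fun j : ℕ => (Fintype.card ι * (1 / ((j : ℝ) + 1)) : ℝ))
      Filter.atTop (nhds 0) := by
    simpa using tendsto_one_div_add_atTop_nhds_zero_nat.const_mul (Fintype.card ι : ℝ)
  have hsq : Filter.Tendsto (fun j => ‖translate (S i) (f j) - f j‖ ^ 2) Filter.atTop
      (nhds 0) := by
    refine squeeze_zero' (.of_forall fun _ => sq_nonneg _) ?_
      (by simpa only [mul_zero] using hlim.const_mul 4)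
    filter_upwards [hlim.eventually (gt_mem_nhds (show (0 : ℝ) < 2 by norm_num))] with j hj
    rcases hfi j i with h' | h'
    · exact h'
    · linarith
  have := hsq.sqrt
  simpa [Real.sqrt_sq (norm_nonneg _)] using this

/-- The push-forward of an invariant mean along an equivariant map. -/
def InvariantMean.map {G X Y : Type*} [Group G] [MulAction G X] [MulAction G Y]
    (m : InvariantMean G X) (π : X → Y) (hπ : ∀ (g : G) x, π (g • x) = g • π x) :
    InvariantMean G Y where
  mass A := m.mass (π ⁻¹' A)
  mass_nonneg _ := m.mass_nonneg _
  mass_univ := m.mass_univ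
  mass_union A B h := m.mass_union _ _ (h.preimage π)
  mass_preimage g A := by
    rw [← m.mass_preimage g (π ⁻¹' A)]
    congr 1
    ext x
    simp [hπ]

/-! ### Ends, vertices and elementary intervals. -/

/-- The vertex at depth `N` on the way to an end. -/
def initialWord {n : ℕ} (y : CantorK n) (N : ℕ) : List (Fin n) :=
  List.ofFn fun k : Fin N => y k

/-- The elementary interval below a vertex. -/
def cylinder {n : ℕ} (b : List (Fin n)) : Set (CantorK n) :=
  Set.range (prepend b)

section Words

variable {n : ℕ}

theorem length_initialWord (y : CantorK n) (N : ℕ) : (initialWord y N).length = N := by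
  simp [initialWord]

theorem initialWord_succ (y : CantorK n) (N : ℕ) :
    initialWord y (N + 1) = initialWord y N ++ [y N] := by
  rw [initialWord, List.ofFn_succ_last]
  rfl

theorem prepend_initialWord (y : CantorK n) (N : ℕ) :
    prepend (initialWord y N) (fun k => y (N + k)) = y := by
  induction N with
  | zero => funext k; simp [initialWord, prepend]
  | succ N ih =>
    rw [initialWord_succ, prepend_append]
    conv_rhs => rw [← ih]
    rw [exists_eq_prepend_singleton fun k => y (N + k)]
    congr 2
    funext k
    congr 1
    omega

theorem initialWord_prepend (b : List (Fin n)) (x : CantorK n) :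
    initialWord (prepend b x) b.length = b := by
  induction b with
  | nil => simp [initialWord]
  | cons i b ih =>
    rw [initialWord, List.length_cons, List.ofFn_succ]
    exact congrArg (List.cons i) ih

theorem mem_cylinder_iff {b : List (Fin n)} {y : CantorK n} :
    y ∈ cylinder b ↔ initialWord y b.length = b := by
  constructor
  · rintro ⟨x, rfl⟩
    exact initialWord_prepend b x
  · intro h
    rw [← h]
    exact ⟨_, prepend_initialWord y b.length⟩

theorem mem_cylinder_initialWord (y : CantorK n) (N : ℕ) : y ∈ cylinder (initialWord y N) :=
  ⟨_, prepend_initialWord y N⟩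

theorem cylinder_append_subset (b c : List (Fin n)) : cylinder (b ++ c) ⊆ cylinder b := by
  rintro _ ⟨x, rfl⟩
  exact ⟨prepend c x, (prepend_append b c x).symm⟩

theorem cylinder_nil : cylinder ([] : List (Fin n)) = Set.univ :=
  Set.eq_univ_of_forall fun x => ⟨x, rfl⟩

theorem cylinder_eq_iUnion (b : List (Fin n)) : cylinder b = ⋃ i, cylinder (b ++ [i]) := by
  refine Set.Subset.antisymm ?_ (Set.iUnion_subset fun i => cylinder_append_subset b [i])
  rintro _ ⟨x, rfl⟩
  refine Set.mem_iUnion.2 ⟨x 0, fun k => x (k + 1), ?_⟩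
  rw [prepend_append, ← exists_eq_prepend_singleton x]

theorem disjoint_cylinder_of_length_eq {b c : List (Fin n)} (h : b.length = c.length)
    (hne : b ≠ c) : Disjoint (cylinder b) (cylinder c) := by
  rw [Set.disjoint_left]
  intro x hb hc
  rw [mem_cylinder_iff] at hb hc
  exact hne (hb.symm.trans (h ▸ hc))

theorem cylinder_initialWord_antitone (y : CantorK n) :
    Antitone fun N => cylinder (initialWord y N) :=
  antitone_nat_of_succ_le fun N => by
    rw [initialWord_succ]
    exact cylinder_append_subset _ _

theorem cylinder_subset_cylinder_initialWord {b : List (Fin n)} {y : CantorK n}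
    (hy : y ∈ cylinder b) {N : ℕ} (hN : N ≤ b.length) :
    cylinder b ⊆ cylinder (initialWord y N) := by
  have h := mem_cylinder_iff.1 hy
  conv_lhs => rw [← h]
  exact cylinder_initialWord_antitone y hN

theorem cylinder_subset_cylinder_take (b : List (Fin n)) (N : ℕ) :
    cylinder b ⊆ cylinder (b.take N) := by
  conv_lhs => rw [← List.take_append_drop N b]
  exact cylinder_append_subset _ _

theorem exists_initialWord_ne {y z : CantorK n} (h : y ≠ z) :
    ∃ N, ∀ M, N ≤ M → initialWord y M ≠ initialWord z M := by
  obtain ⟨k, hk⟩ := Function.ne_iff.1 h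
  refine ⟨k + 1, fun M hM e => hk ?_⟩
  exact congrFun (List.ofFn_injective e) ⟨k, hM⟩

/-- Kőnig's lemma. -/
theorem exists_end_of_step (P : List (Fin n) → Prop) (h0 : P [])
    (hs : ∀ b, P b → ∃ i, P (b ++ [i])) : ∃ y : CantorK n, ∀ N, P (initialWord y N) := by
  choose f hf using fun b : {b // P b} => hs b.1 b.2
  let c : ℕ → {b // P b} := Nat.rec ⟨[], h0⟩ fun _ b => ⟨b.1 ++ [f b], hf b⟩
  have hc : ∀ N, initialWord (fun k => f (c k)) N = (c N).1 := by
    intro N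
    induction N with
    | zero => simp [initialWord, c]
    | succ N ih => rw [initialWord_succ, ih]
  exact ⟨fun k => f (c k), fun N => (hc N).symm ▸ (c N).2⟩

end Words

/-! ### From an invariant mean to a finite orbit. -/

namespace InvariantMean

variable {G X : Type*} [Group G] [MulAction G X] (m : InvariantMean G X)

theorem mass_empty : m.mass ∅ = 0 := by
  have := m.mass_union ∅ ∅ disjoint_bot_left
  rw [Set.union_empty] at this
  linarith

theorem mass_mono {A B : Set X} (h : A ⊆ B) : m.mass A ≤ m.mass B := by
  have := m.mass_union A (B \ A) Set.disjoint_sdiff_right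
  rw [Set.union_sdiff_cancel h] at this
  linarith [m.mass_nonneg (B \ A)]

theorem mass_le_one (A : Set X) : m.mass A ≤ 1 :=
  m.mass_univ ▸ m.mass_mono (Set.subset_univ A)

theorem mass_biUnion {ι : Type*} (s : Finset ι) (A : ι → Set X)
    (h : (s : Set ι).PairwiseDisjoint A) : m.mass (⋃ i ∈ s, A i) = ∑ i ∈ s, m.mass (A i) := by
  classical
  induction s using Finset.induction_on with
  | empty => simp [mass_empty]
  | insert a s ha ih =>
    rw [Finset.set_biUnion_insert, Finset.sum_insert ha, m.mass_union, ih]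
    · exact h.subset (by simp)
    · rw [Set.disjoint_iUnion₂_right]
      intro i hi
      exact h (by simp) (by simp [hi]) (by rintro rfl; exact ha hi)

theorem mass_image (g : G) (A : Set X) : m.mass ((fun x => g • x) '' A) = m.mass A := by
  rw [← m.mass_preimage g, Set.preimage_image_eq _ (MulAction.injective g)]

end InvariantMean

/-- On deep enough elementary intervals, the group element acts by replacing the prefix, and it
shortens prefixes by a bounded amount. -/
def PrefixReplacing {n : ℕ} {G : Type*} [Group G] [MulAction G (CantorK n)] (g : G) : Prop :=
  ∃ L : ℕ, ∀ b : List (Fin n), L ≤ b.length →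
    ∃ b' : List (Fin n), g • prepend b = prepend b' ∧ b.length ≤ b'.length + L

section FiniteOrbit

variable {n : ℕ} {G : Type*} [Group G] [MulAction G (CantorK n)]

theorem image_cylinder {g : G} {b c : List (Fin n)} (h : g • prepend b = prepend c) :
    (fun x => g • x) '' cylinder b = cylinder c := by
  rw [cylinder, cylinder, ← h, ← Set.range_comp]
  rfl

theorem smul_mem_cylinder {g : G} {b c : List (Fin n)} (h : g • prepend b = prepend c)
    {x : CantorK n} (hx : x ∈ cylinder b) : g • x ∈ cylinder c :=
  image_cylinder h ▸ Set.mem_image_of_mem _ hx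

theorem InvariantMean.mass_cylinder_eq (m : InvariantMean G (CantorK n)) {g : G}
    {b c : List (Fin n)} (h : g • prepend b = prepend c) :
    m.mass (cylinder b) = m.mass (cylinder c) := by
  rw [← image_cylinder h, m.mass_image]

theorem InvariantMean.exists_mass_append_pos (m : InvariantMean G (CantorK n))
    {b : List (Fin n)} (hb : 0 < m.mass (cylinder b)) :
    ∃ i, 0 < m.mass (cylinder (b ++ [i])) := by
  by_contra! h
  have e := m.mass_biUnion Finset.univ (fun i => cylinder (b ++ [i])) (by
    intro i _ j _ hij
    exact disjoint_cylinder_of_length_eq (by simp) (by simpa using hij))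
  simp only [Finset.mem_univ, Set.iUnion_true] at e
  rw [← cylinder_eq_iUnion] at e
  have := Finset.sum_nonpos fun i (_ : i ∈ Finset.univ) => h i
  linarith

/-- The points all of whose neighbourhoods have mass at least `α` form a finite set. -/
theorem InvariantMean.finite_atoms (m : InvariantMean G (CantorK n)) {α : ℝ} (hα : 0 < α) :
    {z : CantorK n | ∀ N, α ≤ m.mass (cylinder (initialWord z N))}.Finite := by
  by_contra hinf
  obtain ⟨r, hr⟩ := exists_nat_gt α⁻¹
  obtain ⟨s, hs, hcard⟩ := (show Set.Infinite _ from hinf).exists_subset_card_eq r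
  have hsep : ∀ p : CantorK n × CantorK n, ∃ N, p.1 ≠ p.2 →
      ∀ M, N ≤ M → initialWord p.1 M ≠ initialWord p.2 M := by
    intro p
    by_cases hp : p.1 = p.2
    · exact ⟨0, fun h => (h hp).elim⟩
    · obtain ⟨N, hN⟩ := exists_initialWord_ne hp
      exact ⟨N, fun _ => hN⟩
  choose N hN using hsep
  -- At this depth the `r` chosen points lie in pairwise disjoint intervals, of total mass at least
  -- `r * α > 1`.
  let M := ∑ p ∈ s ×ˢ s, N p
  have hdisj : (s : Set (CantorK n)).PairwiseDisjoint fun z => cylinder (initialWord z M) := by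
    intro y hy z hz hyz
    refine disjoint_cylinder_of_length_eq (by simp [length_initialWord]) ?_
    exact hN (y, z) hyz M (Finset.single_le_sum (f := N) (fun _ _ => Nat.zero_le _)
      (Finset.mem_product.2 ⟨hy, hz⟩))
  have h1 := m.mass_biUnion s _ hdisj
  have h2 := m.mass_le_one (⋃ z ∈ s, cylinder (initialWord z M))
  have h3 : (r : ℝ) * α ≤ ∑ z ∈ s, m.mass (cylinder (initialWord z M)) := by
    rw [← hcard, ← nsmul_eq_mul]
    exact Finset.card_nsmul_le_sum _ _ _ fun z hz => hs hz M
  have h4 : 1 < (r : ℝ) * α := by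
    rwa [inv_lt_iff_one_lt_mul₀ hα] at hr
  linarith

/-- The group preserves the finite set of ends whose intervals all have mass at least `α`: an
interval of depth `N + L` around `y` goes to one of depth at least `N` around `g • y`, with the same
mass. -/
theorem InvariantMean.finite_orbit_of_atom (m : InvariantMean G (CantorK n))
    (hG : ∀ g : G, PrefixReplacing (n := n) g) {y : CantorK n} {α : ℝ} (hα : 0 < α)
    (hy : ∀ N, α ≤ m.mass (cylinder (initialWord y N))) :
    (Set.range fun g : G => g • y).Finite := by
  refine (m.finite_atoms hα).subset ?_
  rintro _ ⟨g, rfl⟩ N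
  obtain ⟨L, hL⟩ := hG g
  obtain ⟨b, hb, hlen⟩ := hL (initialWord y (N + L)) (by rw [length_initialWord]; omega)
  rw [length_initialWord] at hlen
  calc α ≤ m.mass (cylinder (initialWord y (N + L))) := hy _
    _ = m.mass (cylinder b) := m.mass_cylinder_eq hb
    _ ≤ _ := m.mass_mono (cylinder_subset_cylinder_initialWord
      (smul_mem_cylinder hb (mem_cylinder_initialWord _ _)) (by omega))

/-- A finite family of prefix-replacing elements admits a uniform bound. -/
theorem exists_uniform_prefix_bound {ι : Type*} [Finite ι] (S : ι → G)
    (hS : ∀ i, PrefixReplacing (n := n) (S i)) :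
    ∃ L : ℕ, ∀ (i : ι) (b : List (Fin n)), L ≤ b.length →
      ∃ b' : List (Fin n), S i • prepend b = prepend b' ∧ b.length ≤ b'.length + L := by
  cases nonempty_fintype ι
  choose L hL using hS
  refine ⟨∑ i, L i, fun i b hb => ?_⟩
  have hi : L i ≤ ∑ i, L i := Finset.single_le_sum (fun _ _ => Nat.zero_le _) (Finset.mem_univ i)
  obtain ⟨b', h1, h2⟩ := hL i b (hi.trans hb)
  exact ⟨b', h1, h2.trans (by omega)⟩

/-- An infinite set of vertices has an end all of whose vertices have a descendant in the set. -/
theorem exists_end_of_infinite {O : Set (List (Fin n))} (hO : O.Infinite) :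
    ∃ y : CantorK n, ∀ N, ∃ c, initialWord y N ++ c ∈ O := by
  obtain ⟨y, hy⟩ := exists_end_of_step (fun b => {c | b ++ c ∈ O}.Infinite) (by simpa using hO) (by
    intro b hb
    by_contra! h
    refine hb ((Set.Finite.union (Set.finite_singleton [])
      (Set.finite_iUnion fun i => (h i).image (List.cons i))).subset ?_)
    rintro (_ | ⟨i, c⟩) hc
    · exact Or.inl rfl
    · exact Or.inr (Set.mem_iUnion.2 ⟨i, c, by simpa using hc, rfl⟩))
  exact ⟨y, fun N => (hy N).nonempty⟩

/-- A finitely generated group of prefix-replacing maps with an invariant mean on the Cantor set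
has a finite orbit. -/
theorem InvariantMean.exists_finite_orbit {ι : Type*} [Finite ι]
    (m : InvariantMean G (CantorK n))
    (hG : ∀ g : G, PrefixReplacing (n := n) g) (S : ι → G)
    (hS : Subgroup.closure (Set.range S) = ⊤) (hinv : ∀ i, ∃ j, S j = (S i)⁻¹) :
    ∃ y : CantorK n, (Set.range fun g : G => g • y).Finite := by
  obtain ⟨L, hL⟩ := exists_uniform_prefix_bound S fun i => hG (S i)
  obtain ⟨y, hy⟩ := exists_end_of_step (fun b => 0 < m.mass (cylinder b))
    (by simp [cylinder_nil, m.mass_univ]) fun b hb => m.exists_mass_append_pos hb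
  -- Do the images of the intervals around `y` stay deeper than `L`? If so, every generator can be
  -- applied to them as a prefix change again and again.
  by_cases hcase : ∃ N₀, ∀ N, N₀ ≤ N → ∀ (g : G) (b : List (Fin n)),
      g • prepend (initialWord y N) = prepend b → L < b.length
  · obtain ⟨N₀, hN₀⟩ := hcase
    have hall : ∀ g : G, ∃ b : List (Fin n), g • prepend (initialWord y N₀) = prepend b := by
      intro g
      have step : ∀ (i : ι) (k : G),
          (∃ b : List (Fin n), k • prepend (initialWord y N₀) = prepend b) →
          ∃ b : List (Fin n), (S i * k) • prepend (initialWord y N₀) = prepend b := by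
        rintro i k ⟨b, hb⟩
        obtain ⟨b', hb', -⟩ := hL i b (hN₀ N₀ le_rfl k b hb).le
        exact ⟨b', by rw [mul_smul, hb, hb']⟩
      have hg : g ∈ Subgroup.closure (Set.range S) := hS ▸ Subgroup.mem_top g
      induction hg using Subgroup.closure_induction_left with
      | one => exact ⟨_, one_smul _ _⟩
      | mul_left g hg k _ ih =>
        obtain ⟨i, rfl⟩ := hg
        exact step i k ih
      | inv_mul_cancel g hg k _ ih =>
        obtain ⟨i, rfl⟩ := hg
        obtain ⟨j, hj⟩ := hinv i
        rw [← hj]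
        exact step j k ih
    let O : Set (List (Fin n)) := {b | ∃ g : G, g • prepend (initialWord y N₀) = prepend b}
    by_cases hO : O.Finite
    · refine ⟨y, (hO.image fun b => prepend b fun k => y (N₀ + k)).subset ?_⟩
      rintro _ ⟨g, rfl⟩
      obtain ⟨b, hb⟩ := hall g
      refine ⟨b, ⟨g, hb⟩, ?_⟩
      exact (congrFun hb _).symm.trans (congrArg (g • ·) (prepend_initialWord y N₀))
    -- Each interval around `z` contains a translate of the interval at `N₀`, so `z` is heavy.
    · obtain ⟨z, hz⟩ := exists_end_of_infinite hO
      refine ⟨z, m.finite_orbit_of_atom hG (hy N₀) fun N => ?_⟩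
      obtain ⟨c, g, hg⟩ := hz N
      rw [m.mass_cylinder_eq hg]
      exact m.mass_mono (cylinder_append_subset _ _)
  · push Not at hcase
    have hfin : {b : List (Fin n) | b.length < L + 1 ∧ 0 < m.mass (cylinder b)}.Finite :=
      (List.finite_length_lt _ _).subset fun b hb => hb.1
    -- Arbitrarily small intervals around `y` have translates of depth at most `L`. These have
    -- finitely many possible masses, so the least positive one makes `y` heavy.
    obtain ⟨δ, hδ, hle⟩ : ∃ δ > 0, ∀ b : List (Fin n), b.length ≤ L → 0 < m.mass (cylinder b) →
        δ ≤ m.mass (cylinder b) := by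
      have hne : {b : List (Fin n) | b.length < L + 1 ∧ 0 < m.mass (cylinder b)}.Nonempty :=
        ⟨[], by simp [cylinder_nil, m.mass_univ]⟩
      obtain ⟨b, hb, hmin⟩ := hfin.exists_minimalFor (fun b => m.mass (cylinder b)) _ hne
      refine ⟨_, hb.2, fun c hc hpos => ?_⟩
      by_contra! hlt
      exact absurd (hmin ⟨by omega, hpos⟩ hlt.le) hlt.not_ge
    refine ⟨y, m.finite_orbit_of_atom hG hδ fun N => ?_⟩
    obtain ⟨M, hM, g, b, hb, hlen⟩ := hcase N
    have e := m.mass_cylinder_eq hb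
    calc δ ≤ m.mass (cylinder b) := hle b hlen (e ▸ hy M)
      _ = m.mass (cylinder (initialWord y M)) := e.symm
      _ ≤ _ := m.mass_mono (cylinder_initialWord_antitone y hM)

end FiniteOrbit

/-! ### Elementary probability on finite types. -/

open Classical in
/-- The proportion of the elements of a finite type that have a property. -/
noncomputable def freq {Ω : Type*} [Fintype Ω] (p : Ω → Prop) : ℝ :=
  (∑ ω, if p ω then 1 else 0) / Fintype.card Ω

section Freq

variable {Ω Ω' : Type*} [Fintype Ω] [Fintype Ω']

theorem freq_nonneg (p : Ω → Prop) : 0 ≤ freq p :=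
  div_nonneg (Finset.sum_nonneg fun _ _ => by split_ifs <;> norm_num) (Nat.cast_nonneg _)

theorem freq_mono {p q : Ω → Prop} (h : ∀ ω, p ω → q ω) : freq p ≤ freq q := by
  refine div_le_div_of_nonneg_right (Finset.sum_le_sum fun ω _ => ?_) (Nat.cast_nonneg _)
  by_cases hp : p ω
  · simp [hp, h ω hp]
  · rw [if_neg hp]
    split_ifs <;> norm_num

open Classical in
theorem freq_le_one (p : Ω → Prop) : freq p ≤ 1 := by
  refine div_le_one_of_le₀ ?_ (Nat.cast_nonneg _)
  calc (∑ ω, if p ω then (1 : ℝ) else 0) ≤ ∑ _ω : Ω, (1 : ℝ) :=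
        Finset.sum_le_sum fun ω _ => by split_ifs <;> norm_num
    _ = Fintype.card Ω := by simp

theorem freq_false : freq (fun _ : Ω => False) = 0 := by
  simp [freq]

theorem freq_or_le (p q : Ω → Prop) : freq (fun ω => p ω ∨ q ω) ≤ freq p + freq q := by
  rw [freq, freq, freq, ← add_div, ← Finset.sum_add_distrib]
  refine div_le_div_of_nonneg_right (Finset.sum_le_sum fun ω _ => ?_) (Nat.cast_nonneg _)
  by_cases hp : p ω <;> by_cases hq : q ω <;> simp [hp, hq]

theorem freq_exists_le {β : Type*} (s : Finset β) (p : β → Ω → Prop) :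
    freq (fun ω => ∃ b ∈ s, p b ω) ≤ ∑ b ∈ s, freq (p b) := by
  classical
  induction s using Finset.induction_on with
  | empty => simp [freq_false]
  | insert a s ha ih =>
    rw [Finset.sum_insert ha]
    refine le_trans (freq_mono fun ω h => ?_)
      ((freq_or_le (p a) fun ω => ∃ b ∈ s, p b ω).trans (by linarith))
    simpa using h

theorem freq_exists_le_card_mul {β : Type*} (s : Finset β) (p : β → Ω → Prop) {η : ℝ}
    (h : ∀ b ∈ s, freq (p b) ≤ η) : freq (fun ω => ∃ b ∈ s, p b ω) ≤ s.card * η := by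
  refine (freq_exists_le s p).trans ?_
  rw [← nsmul_eq_mul]
  exact Finset.sum_le_card_nsmul s _ η h

open Classical in
theorem freq_comp_equiv (e : Ω ≃ Ω') (p : Ω' → Prop) : freq (fun ω => p (e ω)) = freq p := by
  rw [freq, freq, Fintype.card_congr e]
  congr 1
  exact e.sum_comp fun ω => if p ω then 1 else 0

theorem freq_prod (p : Ω × Ω' → Prop) :
    freq p = (∑ a, freq fun b => p (a, b)) / Fintype.card Ω := by
  simp only [freq]
  rw [← Finset.sum_div, div_div, Fintype.sum_prod_type, Fintype.card_prod, Nat.cast_mul,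
    mul_comm (Fintype.card Ω : ℝ)]

/-- Conditioning on the first coordinate: the event forces `q`, and given `q` its probability is at
most `η`. -/
theorem freq_prod_le_mul {p : Ω × Ω' → Prop} {q : Ω → Prop} {η : ℝ}
    (hq : ∀ a b, p (a, b) → q a) (hη : ∀ a, q a → freq (fun b => p (a, b)) ≤ η) :
    freq p ≤ freq q * η := by
  rw [freq_prod, freq, div_mul_eq_mul_div, Finset.sum_mul]
  refine div_le_div_of_nonneg_right (Finset.sum_le_sum fun a _ => ?_) (Nat.cast_nonneg _)
  by_cases ha : q a
  · simpa [ha] using hη a ha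
  · rw [show (fun b => p (a, b)) = fun _ => False from funext fun b => eq_false fun h => ha (hq a b h),
      freq_false]
    simp [ha]

theorem freq_prod_le {p : Ω × Ω' → Prop} {η : ℝ} (h0 : 0 ≤ η)
    (hη : ∀ a, freq (fun b => p (a, b)) ≤ η) : freq p ≤ η :=
  (freq_prod_le_mul (q := fun _ => True) (fun _ _ _ => trivial) fun a _ => hη a).trans
    (mul_le_of_le_one_left h0 (freq_le_one _))

theorem exists_not_of_freq_lt_one [Nonempty Ω] {p : Ω → Prop} (h : freq p < 1) :
    ∃ ω, ¬ p ω := by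
  by_contra! hp
  have : freq p = 1 := by
    simp [freq, hp]
  linarith

/-- Distinct coordinates are independent, so coordinate `j` can be drawn last, after `w i` is fixed.
-/
theorem freq_pi_le {κ : Type*} [Fintype κ] [DecidableEq κ] {p : Ω → Ω → Prop} {η : ℝ}
    (h0 : 0 ≤ η) (hη : ∀ a, freq (p a) ≤ η) {i j : κ} (hij : i ≠ j) :
    freq (fun w : κ → Ω => p (w i) (w j)) ≤ η := by
  let e := (Equiv.funSplitAt j Ω).trans (Equiv.prodComm _ _)
  have : (fun w : κ → Ω => p (w i) (w j)) = fun w => p ((e w).1 ⟨i, hij⟩) (e w).2 := by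
    funext w
    simp [e, Equiv.funSplitAt, Equiv.piSplitAt]
  rw [this, freq_comp_equiv e fun x => p (x.1 ⟨i, hij⟩) x.2]
  exact freq_prod_le h0 fun a => hη _

theorem freq_pi_apply_le {κ : Type*} [Fintype κ] [DecidableEq κ] {p : Ω → Prop} {η : ℝ}
    (h0 : 0 ≤ η) (hη : freq p ≤ η) (j : κ) : freq (fun w : κ → Ω => p (w j)) ≤ η := by
  let e := (Equiv.funSplitAt j Ω).trans (Equiv.prodComm _ _)
  refine (freq_comp_equiv e fun x => p x.2).trans_le ?_
  exact freq_prod_le h0 fun _ => hη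

end Freq

/-! ### Random words and their transition probabilities. -/

section WordProd

variable {G ι : Type*} [Group G]

/-- The product in a group of a word in the letters `S i`. -/
def wordProd (S : ι → G) {k : ℕ} (w : Fin k → ι) : G :=
  (List.ofFn fun j => S (w j)).prod

theorem wordProd_zero (S : ι → G) (w : Fin 0 → ι) : wordProd S w = 1 := by
  simp [wordProd]

theorem wordProd_cons (S : ι → G) {k : ℕ} (i : ι) (w : Fin k → ι) :
    wordProd S (Fin.cons i w : Fin (k + 1) → ι) = S i * wordProd S w := by
  simp [wordProd, List.ofFn_succ]

theorem wordProd_append (S : ι → G) {j k : ℕ} (v : Fin j → ι) (w : Fin k → ι) :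
    wordProd S (Fin.append v w) = wordProd S v * wordProd S w := by
  rw [wordProd, wordProd, wordProd, ← List.prod_append, ← List.ofFn_fin_append]
  congr 2
  funext i
  refine Fin.addCases (fun i => ?_) (fun i => ?_) i <;> simp

/-- Reversing a word and inverting its letters is a bijection of words when `σ` is one, so the
inverse of a random product is distributed like the product itself. -/
theorem wordProd_rev (S : ι → G) (σ : ι → ι) (hσ : ∀ i, S (σ i) = (S i)⁻¹) {k : ℕ}
    (w : Fin k → ι) : wordProd S (fun j => σ (w j.rev)) = (wordProd S w)⁻¹ := by
  rw [wordProd, wordProd, List.prod_inv_reverse]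
  congr 1
  refine List.ext_getElem (by simp) fun i h₁ h₂ => ?_
  simp only [List.getElem_ofFn, List.getElem_reverse, List.getElem_map, hσ]
  congr 3
  ext
  simp [Fin.rev]
  omega

theorem freq_cons [Fintype ι] {k : ℕ} (p : (Fin (k + 1) → ι) → Prop) :
    freq p = freq fun x : ι × (Fin k → ι) => p (Fin.cons x.1 x.2) :=
  (freq_comp_equiv (Fin.consEquiv fun _ => ι) p).symm

theorem freq_cons_le [Fintype ι] {k : ℕ} {p : (Fin (k + 1) → ι) → Prop}
    {q : (Fin k → ι) → Prop} (h : ∀ i w, p (Fin.cons i w) → q w) : freq p ≤ freq q := by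
  rw [freq_cons]
  exact freq_prod_le (freq_nonneg q) fun i => freq_mono (h i)

theorem freq_append [Fintype ι] {j k : ℕ} (p : (Fin (j + k) → ι) → Prop) :
    freq p = freq fun x : (Fin k → ι) × (Fin j → ι) => p (Fin.append x.2 x.1) :=
  (freq_comp_equiv ((Equiv.prodComm _ _).trans (Fin.appendEquiv j k)) p).symm

open EllTwo in
/-- A spectral gap makes the transition probabilities of the random walk decay exponentially. -/
theorem freq_wordProd_smul_eq_le {Ω : Type*} [MulAction G Ω] [Fintype ι] (S : ι → G) {ρ : ℝ}
    (h0 : 0 ≤ ρ) (hρ : ∀ f : EllTwo Ω, ‖average S f‖ ≤ ρ * ‖f‖) (k : ℕ) (x y : Ω) :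
    freq (fun w : Fin k → ι => wordProd S w • x = y) ≤ ρ ^ k := by
  classical
  -- The iterates of the averaging operator on the point mass at `x` are the distributions of the
  -- random walk started at `x`.
  let F : ℕ → EllTwo Ω := fun k => (average S)^[k] (lp.single 2 x (1 : ℝ))
  have hF : ∀ k y, F k y = freq (fun w : Fin k → ι => wordProd S w • x = y) := by
    intro k
    induction k with
    | zero =>
      intro y
      by_cases h : x = y
      · subst h
        simp [F, freq, wordProd_zero]
      · simp [F, freq, wordProd_zero, h, Ne.symm h]
    | succ k ih =>
      intro y
      have e : F (k + 1) = average S (F k) := Function.iterate_succ_apply' _ _ _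
      rw [e, average_apply, freq_cons, freq_prod]
      have hi : ∀ i, (freq fun w : Fin k → ι => wordProd S (Fin.cons i w : Fin (k + 1) → ι) • x = y) =
          F k ((S i)⁻¹ • y) := by
        intro i
        rw [ih]
        simp only [wordProd_cons, mul_smul, eq_inv_smul_iff]
      simp only [hi]
      rw [div_eq_inv_mul, lp.coeFn_smul, lp.coeFn_sum, Pi.smul_apply, Finset.sum_apply, smul_eq_mul]
      rfl
  have hnorm : ∀ k, ‖F k‖ ≤ ρ ^ k := by
    intro k
    induction k with
    | zero => simp [F, lp.norm_single]
    | succ k ih =>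
      have e : F (k + 1) = average S (F k) := Function.iterate_succ_apply' _ _ _
      rw [e, pow_succ']
      exact (hρ _).trans (mul_le_mul_of_nonneg_left ih h0)
  rw [← hF]
  exact (le_abs_self _).trans ((lp.norm_apply_le_norm (by norm_num) (F k) y).trans (hnorm k))

end WordProd

/-! ### Contraction of intervals by long random words. -/

section Contraction

variable {n : ℕ} {G : Type*} [Group G] [MulAction G (CantorK n)]

/-- The group element maps the elementary interval below `b` onto an elementary interval of depth
at least `l`, by replacing the prefix. -/
def MapsDeep (g : G) (b : List (Fin n)) (l : ℕ) : Prop :=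
  ∃ b' : List (Fin n), l ≤ b'.length ∧ g • prepend b = prepend b'

/-- The group element maps the elementary interval below `c` into an elementary interval below
some vertex in `D`. -/
def IsCaptured (g : G) (c : List (Fin n)) (D : Finset (List (Fin n))) : Prop :=
  ∃ b ∈ D, ∀ x ∈ cylinder c, g • x ∈ cylinder b

theorem MapsDeep.exists_subset {g : G} {b : List (Fin n)} {l : ℕ} (h : MapsDeep g b l) :
    ∃ c : List (Fin n), c.length = l ∧ ∀ x ∈ cylinder b, g • x ∈ cylinder c := by
  obtain ⟨b', hl, hb'⟩ := h
  exact ⟨b'.take l, by simpa using hl, fun x hx =>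
    cylinder_subset_cylinder_take b' l (smul_mem_cylinder hb' hx)⟩

variable {ι : Type*}

/-- A deterministic bound: each letter costs at most `L` levels of depth. -/
theorem mapsDeep_wordProd {S : ι → G} {L : ℕ}
    (hL : ∀ (i : ι) (b : List (Fin n)), L ≤ b.length →
      ∃ b' : List (Fin n), S i • prepend b = prepend b' ∧ b.length ≤ b'.length + L)
    {k m : ℕ} (w : Fin k → ι) (b : List (Fin n)) (hb : m + L * k ≤ b.length) :
    MapsDeep (wordProd S w) b m := by
  suffices h : ∃ b' : List (Fin n), b.length ≤ b'.length + L * k ∧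
      wordProd S w • prepend b = prepend b' by
    obtain ⟨b', h1, h2⟩ := h
    exact ⟨b', by omega, h2⟩
  replace hb : L * k ≤ b.length := by omega
  induction k with
  | zero => exact ⟨b, by simp, by rw [wordProd_zero, one_smul]⟩
  | succ k ih =>
    induction w using Fin.consCases with
    | _ i w =>
      rw [Nat.mul_succ] at hb ⊢
      obtain ⟨b', h1, h2⟩ := ih w (by omega)
      obtain ⟨b'', h3, h4⟩ := hL i b' (by omega)
      exact ⟨b'', by omega, by rw [wordProd_cons, mul_smul, h2, h3]⟩

variable [Fintype ι]

/-- The number of vertices of depth less than `r`. -/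
noncomputable def numShort (n r : ℕ) : ℕ := (List.finite_length_lt (Fin n) r).toFinset.card

theorem freq_short_le {S : ι → G} {ρ : ℝ}
    (hρ : ∀ (k : ℕ) (x y : CantorK n → CantorK n),
      freq (fun w : Fin k → ι => wordProd S w • x = y) ≤ ρ ^ k)
    (k r : ℕ) (x : CantorK n → CantorK n) :
    freq (fun w : Fin k → ι => ∃ b : List (Fin n), b.length < r ∧ wordProd S w • x = prepend b) ≤
      numShort n r * ρ ^ k := by
  refine le_trans (freq_mono fun w h => ?_) (freq_exists_le_card_mul
    (List.finite_length_lt (Fin n) r).toFinset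
    (fun b (w : Fin k → ι) => wordProd S w • x = prepend b) fun b _ => hρ k x (prepend b))
  simpa using h

/-- During the first `J` letters the interval is too deep to rise above level `L`. Afterwards the
next letter still acts by a prefix change until the first visit to depth less than `L`. A visit
after `k` letters has probability at most `numShort n L * ρ ^ k`, and the bound is the sum of these
over `k` from `J + 1` to `J + t`. -/
theorem freq_not_mapsDeep_le_geometric {S : ι → G} {L : ℕ}
    (hL : ∀ (i : ι) (b : List (Fin n)), L ≤ b.length →
      ∃ b' : List (Fin n), S i • prepend b = prepend b' ∧ b.length ≤ b'.length + L)
    {ρ : ℝ} (h1 : ρ < 1)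
    (hρ : ∀ (k : ℕ) (x y : CantorK n → CantorK n),
      freq (fun w : Fin k → ι => wordProd S w • x = y) ≤ ρ ^ k)
    {J : ℕ} {b : List (Fin n)} (hb : L + L * J ≤ b.length) (t : ℕ) :
    freq (fun w : Fin (J + t) → ι => ¬ MapsDeep (wordProd S w) b L) ≤
      numShort n L * ρ ^ (J + 1) / (1 - ρ) * (1 - ρ ^ t) := by
  induction t with
  | zero =>
    have : (fun w : Fin (J + 0) → ι => ¬ MapsDeep (wordProd S w) b L) = fun _ => False :=
      funext fun w => eq_false fun h => h (mapsDeep_wordProd hL w b hb)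
    rw [this, freq_false]
    simp
  | succ t ih =>
    have hstep : freq (fun w : Fin (J + t + 1) → ι => ¬ MapsDeep (wordProd S w) b L) ≤
        freq (fun w : Fin (J + t) → ι => ¬ MapsDeep (wordProd S w) b L) +
          numShort n L * ρ ^ (J + t + 1) := by
      let short (w : Fin (J + t + 1) → ι) : Prop :=
        ∃ c : List (Fin n), c.length < L ∧ wordProd S w • prepend b = prepend c
      refine (freq_mono (q := fun w => (¬ MapsDeep (wordProd S w) b L ∧ ¬ short w) ∨ short w)
        fun w h => ?_).trans ((freq_or_le _ _).trans
        (add_le_add (freq_cons_le fun i w => ?_) (freq_short_le hρ _ _ _)))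
      · by_cases hs : short w
        · exact Or.inr hs
        · exact Or.inl ⟨h, hs⟩
      · rintro ⟨hn, hs⟩ ⟨c, hc, hcw⟩
        obtain ⟨c', hc', -⟩ := hL i c hc
        have e : wordProd S (Fin.cons i w : Fin (J + t + 1) → ι) • prepend b = prepend c' := by
          rw [wordProd_cons, mul_smul, hcw, hc']
        rcases lt_or_ge c'.length L with hlt | hge
        · exact hs ⟨c', hlt, e⟩
        · exact hn ⟨c', hge, e⟩
    refine (hstep.trans (add_le_add_left ih _)).trans_eq ?_
    have : 1 - ρ ≠ 0 := by linarith
    field_simp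
    ring

/-- Deep elementary intervals are contracted by long random words with high probability. -/
theorem exists_freq_not_mapsDeep_le {S : ι → G} {L : ℕ}
    (hL : ∀ (i : ι) (b : List (Fin n)), L ≤ b.length →
      ∃ b' : List (Fin n), S i • prepend b = prepend b' ∧ b.length ≤ b'.length + L)
    {ρ : ℝ} (h0 : 0 ≤ ρ) (h1 : ρ < 1)
    (hρ : ∀ (k : ℕ) (x y : CantorK n → CantorK n),
      freq (fun w : Fin k → ι => wordProd S w • x = y) ≤ ρ ^ k)
    {η : ℝ} (hη : 0 < η) :
    ∃ N : ℕ, ∀ l : ℕ, ∃ k₀ : ℕ, ∀ k, k₀ ≤ k → ∀ b : List (Fin n), N ≤ b.length →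
      freq (fun w : Fin k → ι => ¬ MapsDeep (wordProd S w) b l) ≤ η := by
  have hlim : ∀ C : ℝ, ∀ᶠ k in Filter.atTop, C * ρ ^ k ≤ η / 2 := by
    intro C
    have := (tendsto_pow_atTop_nhds_zero_of_lt_one h0 h1).const_mul C
    rw [mul_zero] at this
    exact this.eventually (ge_mem_nhds (by positivity))
  obtain ⟨J, hJ⟩ := (hlim (numShort n L * ρ / (1 - ρ))).exists
  -- The starting depth does not depend on the target depth `l`; only the word length does.
  refine ⟨L + L * J, fun l => ?_⟩
  obtain ⟨k₁, hk₁⟩ := Filter.eventually_atTop.1 (hlim (numShort n l))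
  refine ⟨max J k₁, fun k hk b hb => ?_⟩
  obtain ⟨t, rfl⟩ := Nat.exists_eq_add_of_le ((le_max_left _ _).trans hk)
  refine (freq_mono (q := fun w => ¬ MapsDeep (wordProd S w) b L ∨
    ∃ c : List (Fin n), c.length < l ∧ wordProd S w • prepend b = prepend c)
      fun w h => ?_).trans ((freq_or_le _ _).trans ((add_le_add
        (freq_not_mapsDeep_le_geometric hL h1 hρ hb t) (freq_short_le hρ _ _ _)).trans ?_))
  · by_contra! hc
    obtain ⟨⟨c, _, hcw⟩, h2⟩ := hc
    exact h ⟨c, not_lt.1 fun hlt => h2 c hlt hcw, hcw⟩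
  · have e1 : numShort n L * ρ ^ (J + 1) / (1 - ρ) * (1 - ρ ^ t) ≤ η / 2 := by
      have hp : (0 : ℝ) ≤ numShort n L * ρ ^ (J + 1) / (1 - ρ) :=
        div_nonneg (by positivity) (by linarith)
      refine (mul_le_of_le_one_right hp ?_).trans (le_of_eq_of_le ?_ hJ)
      · linarith [pow_nonneg h0 t]
      · ring
    linarith [hk₁ (J + t) ((le_max_right _ _).trans hk)]

/-- Long random words map every deep elementary interval, with probability at least `1 - η`, into
one of `d` tiny elementary intervals that depend on the word only. -/
def Captures (n : ℕ) {G ι : Type*} [Group G] [MulAction G (CantorK n)] [Fintype ι] (S : ι → G)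
    (η : ℝ) (d : ℕ) : Prop :=
  ∃ M : ℕ, ∀ l : ℕ, ∃ k₀ : ℕ, ∀ k, k₀ ≤ k → ∃ D : (Fin k → ι) → Finset (List (Fin n)),
    (∀ w, (D w).card ≤ d) ∧ (∀ w, ∀ b ∈ D w, b.length = l) ∧
      ∀ c : List (Fin n), M ≤ c.length →
        freq (fun w => ¬ IsCaptured (wordProd S w) c (D w)) ≤ η

theorem captures_one_zero (S : ι → G) : Captures n S 1 0 :=
  ⟨0, fun _ => ⟨0, fun _ _ => ⟨fun _ => ∅, by simp, by simp, fun _ _ => freq_le_one _⟩⟩⟩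

-- Write a word as `u` after `v`, with `v` of fixed length `τ`, and let `b` be the ancestor of `c`
-- at depth `N₀`. With probability at least 1/2, `v` sends `b` to depth `N₁`, and then `u` contracts
-- its image except with probability `ε`. Otherwise the old family for `u` captures the image of `c`
-- except with probability `η`, independently of `v`. The price is one extra target for each vertex
-- of depth `N₀`, a number independent of `η`, `d` and `ε`.
open Classical in
theorem exists_captures_step {S : ι → G} {L : ℕ}
    (hL : ∀ (i : ι) (b : List (Fin n)), L ≤ b.length →
      ∃ b' : List (Fin n), S i • prepend b = prepend b' ∧ b.length ≤ b'.length + L)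
    {ρ : ℝ} (h0 : 0 ≤ ρ) (h1 : ρ < 1)
    (hρ : ∀ (k : ℕ) (x y : CantorK n → CantorK n),
      freq (fun w : Fin k → ι => wordProd S w • x = y) ≤ ρ ^ k) :
    ∃ d₀ : ℕ, ∀ (η : ℝ) (d : ℕ) (ε : ℝ), 0 ≤ η → 0 < ε → Captures n S η d →
      Captures n S (1 / 2 * η + ε) (d + d₀) := by
  obtain ⟨N₀, hN₀⟩ := exists_freq_not_mapsDeep_le hL h0 h1 hρ (η := 1 / 2) (by norm_num)
  let cells := (List.finite_length_eq (Fin n) N₀).toFinset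
  refine ⟨cells.card, ?_⟩
  rintro η d ε hη hε ⟨M, hM⟩
  obtain ⟨N₁, hN₁⟩ := exists_freq_not_mapsDeep_le hL h0 h1 hρ hε
  obtain ⟨τ, hτ⟩ := hN₀ N₁
  -- The term `L * τ` keeps the image of `c` under `v` at depth at least `M`, whatever `v` is.
  refine ⟨N₀ + (M + L * τ), fun l => ?_⟩
  obtain ⟨k₁, hk₁⟩ := hM l
  obtain ⟨k₂, hk₂⟩ := hN₁ l
  refine ⟨max k₁ k₂ + τ, fun k hk => ?_⟩
  obtain ⟨j, rfl⟩ : ∃ j, k = j + τ := ⟨k - τ, by omega⟩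
  replace hk : max k₁ k₂ ≤ j := by omega
  obtain ⟨E, hEcard, hElen, hE⟩ := hk₁ j ((le_max_left _ _).trans hk)
  have hpick : ∀ (g : G) (b : List (Fin n)), ∃ c : List (Fin n), MapsDeep g b l →
      c.length = l ∧ ∀ x ∈ cylinder b, g • x ∈ cylinder c := by
    intro g b
    by_cases h : MapsDeep g b l
    · obtain ⟨c, hc⟩ := h.exists_subset
      exact ⟨c, fun _ => hc⟩
    · exact ⟨[], fun h' => (h h').elim⟩
  choose pick hpick using hpick
  let D (w : Fin (j + τ) → ι) : Finset (List (Fin n)) :=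
    E ((Fin.appendEquiv j τ).symm w).1 ∪
      (cells.filter fun b => MapsDeep (wordProd S w) b l).image (pick (wordProd S w))
  have hD : ∀ (u : Fin j → ι) (v : Fin τ → ι), D (Fin.append u v) = E u ∪
      (cells.filter fun b => MapsDeep (wordProd S (Fin.append u v)) b l).image
        (pick (wordProd S (Fin.append u v))) := by
    intro u v
    have : (Fin.appendEquiv j τ).symm (Fin.append u v) = (u, v) :=
      (Fin.appendEquiv j τ).symm_apply_apply (u, v)
    simp only [D, this]
  refine ⟨D, fun w => ?_, fun w b hb => ?_, fun c hc => ?_⟩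
  · exact (Finset.card_union_le _ _).trans (add_le_add (hEcard _)
      (Finset.card_image_le.trans (Finset.card_filter_le _ _)))
  · rcases Finset.mem_union.1 hb with hb | hb
    · exact hElen _ b hb
    · obtain ⟨a, ha, rfl⟩ := Finset.mem_image.1 hb
      exact (hpick _ a (Finset.mem_filter.1 ha).2).1
  · rw [freq_append]
    let b := c.take N₀
    have hblen : b.length = N₀ := by
      simp only [b, List.length_take]
      omega
    let dead (v : Fin τ → ι) : Prop := ¬ MapsDeep (wordProd S v) b N₁
    let fail (x : (Fin τ → ι) × (Fin j → ι)) : Prop :=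
      ¬ IsCaptured (wordProd S (Fin.append x.2 x.1)) c (D (Fin.append x.2 x.1))
    have hfailE : ∀ v c', wordProd S v • prepend c = prepend c' → ∀ u, fail (v, u) →
        ¬ IsCaptured (wordProd S u) c' (E u) := by
      rintro v c' hc' u hf ⟨a, ha, hau⟩
      refine hf ⟨a, ?_, fun x hx => ?_⟩
      · rw [hD]
        exact Finset.mem_union_left _ ha
      · rw [wordProd_append, mul_smul]
        exact hau _ (smul_mem_cylinder hc' hx)
    have hfailb : ∀ v u, fail (v, u) → ¬ MapsDeep (wordProd S (Fin.append u v)) b l := by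
      intro v u hf hdeep
      refine hf ⟨pick (wordProd S (Fin.append u v)) b, ?_, fun x hx => ?_⟩
      · rw [hD]
        refine Finset.mem_union_right _ (Finset.mem_image_of_mem _ (Finset.mem_filter.2 ⟨?_, hdeep⟩))
        simpa [cells] using hblen
      · exact (hpick _ _ hdeep).2 x (cylinder_subset_cylinder_take c N₀ hx)
    have hdead : freq (fun x : (Fin τ → ι) × (Fin j → ι) => dead x.1 ∧ fail x) ≤ 1 / 2 * η := by
      refine (freq_prod_le_mul (q := dead) (fun v u h => h.1) fun v _ => ?_).trans
        (mul_le_mul_of_nonneg_right (hτ τ le_rfl b hblen.ge) hη)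
      obtain ⟨c', hc'M, hc'⟩ := mapsDeep_wordProd hL (m := M) v c (by omega)
      exact (freq_mono fun u h => hfailE v c' hc' u h.2).trans (hE c' hc'M)
    have halive : freq (fun x : (Fin τ → ι) × (Fin j → ι) => ¬ dead x.1 ∧ fail x) ≤ ε := by
      refine freq_prod_le hε.le fun v => ?_
      by_cases hv : dead v
      · simp only [hv, not_true_eq_false, false_and, freq_false]
        exact hε.le
      · obtain ⟨b', hb'N, hb'⟩ := not_not.1 hv
        refine (freq_mono fun u h => ?_).trans (hk₂ j ((le_max_right _ _).trans hk) b' hb'N)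
        rintro ⟨a, hal, ha⟩
        exact hfailb v u h.2 ⟨a, hal, by rw [wordProd_append, mul_smul, hb', ha]⟩
    refine (freq_mono fun x h => ?_).trans ((freq_or_le _ _).trans (add_le_add hdead halive))
    by_cases hx : dead x.1
    · exact Or.inl ⟨hx, h⟩
    · exact Or.inr ⟨hx, h⟩

/-- After `J` steps the number of targets is `J * d₀` while the failure probability is about `2 ^
(-J)`, so their product tends to zero. -/
theorem exists_captures {S : ι → G} {L : ℕ}
    (hL : ∀ (i : ι) (b : List (Fin n)), L ≤ b.length →
      ∃ b' : List (Fin n), S i • prepend b = prepend b' ∧ b.length ≤ b'.length + L)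
    {ρ : ℝ} (h0 : 0 ≤ ρ) (h1 : ρ < 1)
    (hρ : ∀ (k : ℕ) (x y : CantorK n → CantorK n),
      freq (fun w : Fin k → ι => wordProd S w • x = y) ≤ ρ ^ k) {ε : ℝ} (hε : 0 < ε) :
    ∃ (η : ℝ) (d : ℕ), 0 ≤ η ∧ (d + 1) * η ≤ ε ∧ Captures n S η d := by
  obtain ⟨d₀, hd₀⟩ := exists_captures_step hL h0 h1 hρ
  have hind : ∀ (J : ℕ) (δ : ℝ), 0 < δ → Captures n S ((1 / 2) ^ J + δ) (J * d₀) := by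
    intro J
    induction J with
    | zero =>
      intro δ hδ
      obtain ⟨M, hM⟩ := captures_one_zero (n := n) S
      refine ⟨M, fun l => ?_⟩
      obtain ⟨k₀, hk₀⟩ := hM l
      refine ⟨k₀, fun k hk => ?_⟩
      obtain ⟨D, hD₁, hD₂, -⟩ := hk₀ k hk
      exact ⟨D, by simpa using hD₁, hD₂, fun c _ => (freq_le_one _).trans (by simp; linarith)⟩
    | succ J ih =>
      intro δ hδ
      -- The error `δ` is a fixed point of the recursion: half of it plus `δ / 2`.
      have := hd₀ _ _ (δ / 2) (by positivity) (by positivity) (ih δ hδ)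
      convert this using 1 <;> ring
  have hlim : Filter.Tendsto (fun J : ℕ => (((J * d₀ : ℕ) : ℝ) + 1) * ((1 / 2) ^ J + (1 / 2) ^ J))
      Filter.atTop (nhds 0) := by
    have e1 := (tendsto_self_mul_const_pow_of_lt_one (r := (1 / 2 : ℝ)) (by norm_num)
      (by norm_num)).const_mul (2 * d₀ : ℝ)
    have e2 := (tendsto_pow_atTop_nhds_zero_of_lt_one (r := (1 / 2 : ℝ)) (by norm_num)
      (by norm_num)).const_mul 2
    have := e1.add e2
    rw [mul_zero, mul_zero, add_zero] at this
    refine this.congr fun J => ?_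
    push_cast
    ring
  obtain ⟨J, hJ⟩ := (hlim.eventually (ge_mem_nhds hε)).exists
  exact ⟨_, J * d₀, by positivity, hJ, hind J _ (by positivity)⟩

end Contraction

/-! ### Ping-pong and the free subgroup. -/

/-- A ping-pong lemma that asks for no disjointness of the tables, but for a base point outside
them. -/
theorem injective_lift_of_ping_pong_base {ι G X : Type*} [Group G] [MulAction G X] (a : ι → G)
    (P : ι × Bool → Set X)
    (h : ∀ l l' : ι × Bool, (l.1 = l'.1 → l.2 = l'.2) → ∀ x ∈ P l',
      (bif l.2 then a l.1 else (a l.1)⁻¹) • x ∈ P l)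
    (x₀ : X) (h₀ : ∀ l, (bif l.2 then a l.1 else (a l.1)⁻¹) • x₀ ∈ P l) (hx₀ : ∀ l, x₀ ∉ P l) :
    Function.Injective (FreeGroup.lift a) := by
  classical
  -- A nonempty reduced word moves `x₀` into the table of its first letter, hence cannot act
  -- trivially.
  have key : ∀ (T : List (ι × Bool)) (l : ι × Bool), FreeGroup.IsReduced (l :: T) →
      ((l :: T).map fun l => bif l.2 then a l.1 else (a l.1)⁻¹).prod • x₀ ∈ P l := by
    intro T
    induction T with
    | nil =>
      intro l _
      simpa using h₀ l
    | cons l' T ih =>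
      intro l hl
      obtain ⟨h1, h2⟩ := List.isChain_cons_cons.1 hl
      rw [List.map_cons, List.prod_cons, mul_smul]
      exact h l l' h1 _ (ih l' h2)
  rw [injective_iff_map_eq_one]
  intro x hx
  rw [← FreeGroup.mk_toWord (x := x), FreeGroup.lift_mk] at hx
  have hred : FreeGroup.IsReduced x.toWord := FreeGroup.isReduced_toWord
  rcases hw : x.toWord with _ | ⟨l, T⟩
  · exact FreeGroup.toWord_eq_nil_iff.1 hw
  · rw [hw] at hx hred
    have := key T l hred
    rw [hx, one_smul] at this
    exact (hx₀ l this).elim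

/-- Four elements that contract each other's target sets give a free group of rank two. -/
theorem exists_injective_of_four_contractions {G X : Type*} [Group G] [MulAction G X]
    (g : Fin 4 → G) (Z : Fin 4 → Bool → Set X)
    (h : ∀ i j, i ≠ j → ∀ s, ∀ x ∈ Z i s, g j • x ∈ Z j true ∧ (g j)⁻¹ • x ∈ Z j false)
    (x₀ : X) (h₀ : ∀ j, g j • x₀ ∈ Z j true ∧ (g j)⁻¹ • x₀ ∈ Z j false)
    (hx₀ : ∀ i s, x₀ ∉ Z i s) :
    ∃ φ : FreeGroup (Fin 2) →* G, Function.Injective φ := by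
  -- Nothing is known about `g i` on its own target sets. In powers of a product of two of them, and
  -- in all reduced words, adjacent factors have distinct indices.
  let a : Fin 2 → G := ![g 0 * g 1, g 2 * g 3]
  let P : Fin 2 × Bool → Set X := fun l =>
    bif l.2 then ![Z 0 true, Z 2 true] l.1 else ![Z 1 false, Z 3 false] l.1
  have h01 : ∀ x, g 1 • x ∈ Z 1 true → (g 0 * g 1) • x ∈ Z 0 true := fun x hx => by
    rw [mul_smul]
    exact (h 1 0 (by decide) _ _ hx).1
  have h10 : ∀ x, (g 0)⁻¹ • x ∈ Z 0 false → (g 0 * g 1)⁻¹ • x ∈ Z 1 false := fun x hx => by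
    rw [mul_inv_rev, mul_smul]
    exact (h 0 1 (by decide) _ _ hx).2
  have h23 : ∀ x, g 3 • x ∈ Z 3 true → (g 2 * g 3) • x ∈ Z 2 true := fun x hx => by
    rw [mul_smul]
    exact (h 3 2 (by decide) _ _ hx).1
  have h32 : ∀ x, (g 2)⁻¹ • x ∈ Z 2 false → (g 2 * g 3)⁻¹ • x ∈ Z 3 false := fun x hx => by
    rw [mul_inv_rev, mul_smul]
    exact (h 2 3 (by decide) _ _ hx).2
  refine ⟨FreeGroup.lift a, injective_lift_of_ping_pong_base a P ?_ x₀ ?_ ?_⟩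
  · rintro ⟨i, s⟩ ⟨j, t⟩ hij x hx
    fin_cases i <;> fin_cases j <;> cases s <;> cases t <;> simp [a, P] at hij hx ⊢
    · exact mul_inv_rev (g 0) (g 1) ▸ h10 x (h 1 0 (by decide) _ x hx).2
    · exact h01 x (h 0 1 (by decide) _ x hx).1
    · exact mul_inv_rev (g 0) (g 1) ▸ h10 x (h 3 0 (by decide) _ x hx).2
    · exact mul_inv_rev (g 0) (g 1) ▸ h10 x (h 2 0 (by decide) _ x hx).2
    · exact h01 x (h 3 1 (by decide) _ x hx).1
    · exact h01 x (h 2 1 (by decide) _ x hx).1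
    · exact mul_inv_rev (g 2) (g 3) ▸ h32 x (h 1 2 (by decide) _ x hx).2
    · exact mul_inv_rev (g 2) (g 3) ▸ h32 x (h 0 2 (by decide) _ x hx).2
    · exact h23 x (h 1 3 (by decide) _ x hx).1
    · exact h23 x (h 0 3 (by decide) _ x hx).1
    · exact mul_inv_rev (g 2) (g 3) ▸ h32 x (h 3 2 (by decide) _ x hx).2
    · exact h23 x (h 2 3 (by decide) _ x hx).1
  · rintro ⟨i, s⟩
    fin_cases i <;> cases s <;> simp [a, P]
    · exact mul_inv_rev (g 0) (g 1) ▸ h10 x₀ (h₀ 0).2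
    · exact h01 x₀ (h₀ 1).1
    · exact mul_inv_rev (g 2) (g 3) ▸ h32 x₀ (h₀ 2).2
    · exact h23 x₀ (h₀ 3).1
  · rintro ⟨i, s⟩
    fin_cases i <;> cases s <;> simp [P, hx₀]

/-- Among the extensions of a word by `m` letters, there is one outside any given set of at most
`m` words. -/
theorem exists_extension_notMem {n : ℕ} (hn : 2 ≤ n) (c : List (Fin n)) (m : ℕ)
    (F : Finset (List (Fin n))) (hF : F.card ≤ m) :
    ∃ e : List (Fin n), e.length = m ∧ c ++ e ∉ F := by
  by_contra! h
  have hle : Fintype.card (Fin m → Fin n) ≤ F.card := by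
    rw [← Finset.card_univ]
    refine Finset.card_le_card_of_injOn (fun v => c ++ List.ofFn v)
      (fun v _ => h _ (List.length_ofFn)) fun v _ w _ hvw => ?_
    exact List.ofFn_injective (List.append_cancel_left hvw)
  have := Nat.lt_pow_self (n := m) (show 1 < n by omega)
  simp at hle
  omega

/-- A union bound over independent words `w 0, …, w 3`: with positive probability each word and its
inverse capture all targets of the other words and their inverses, as well as a fixed interval
containing the base point. -/
theorem exists_free_of_captures {n : ℕ} (hn : 2 ≤ n) {G ι : Type*} [Group G]
    [MulAction G (CantorK n)] [Fintype ι] [Nonempty ι] (S : ι → G) (σ : ι ≃ ι)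
    (hσ : ∀ i, S (σ i) = (S i)⁻¹) {η : ℝ} {d : ℕ} (hη : 0 ≤ η) (hd : (d + 1) * η ≤ 1 / 100)
    (h : Captures n S η d) :
    ∃ φ : FreeGroup (Fin 2) →* G, Function.Injective φ := by
  classical
  obtain ⟨M, hM⟩ := h
  -- Depth at least `M` makes the targets themselves liable to capture. The extra `8 * d` leaves
  -- room to avoid all targets, at most `d` for each of the four words and each of their inverses.
  obtain ⟨k, hk⟩ := hM (M + 8 * d)
  obtain ⟨D, hDcard, hDlen, hD⟩ := hk k le_rfl
  let c₀ : List (Fin n) := List.replicate M ⟨0, by omega⟩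
  let V : Bool → (Fin k → ι) ≃ (Fin k → ι) := fun s =>
    bif s then Equiv.refl _ else Equiv.arrowCongr Fin.revPerm σ
  have hV : ∀ w, wordProd S (V false w) = (wordProd S w)⁻¹ := fun w => wordProd_rev S σ hσ w
  let bad (p : Fin 4 × Bool × Fin 4 × Bool) (w : Fin 4 → Fin k → ι) : Prop :=
    (p.1 ≠ p.2.2.1 ∧ ∃ b ∈ D (V p.2.1 (w p.1)),
      ¬ IsCaptured (wordProd S (V p.2.2.2 (w p.2.2.1))) b (D (V p.2.2.2 (w p.2.2.1)))) ∨
    ¬ IsCaptured (wordProd S (V p.2.2.2 (w p.2.2.1))) c₀ (D (V p.2.2.2 (w p.2.2.1)))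
  -- The two clauses cost `d * η` and `η`; there are 64 indices `p`, and 64/100 < 1.
  have hbad : ∀ p, freq (bad p) ≤ 1 / 100 := by
    rintro ⟨i, s, j, t⟩
    refine (freq_or_le _ _).trans (le_trans (add_le_add (b := d * η) (d := η) ?_ ?_) (by linarith))
    · by_cases hij : i = j
      · simp only [hij, ne_eq, not_true_eq_false, false_and, freq_false]
        positivity
      · refine (freq_mono fun w hw => hw.2).trans (freq_pi_le (p := fun u w => ∃ b ∈ D (V s u),
          ¬ IsCaptured (wordProd S (V t w)) b (D (V t w))) (by positivity) (fun u => ?_) hij)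
        refine (freq_exists_le_card_mul _ _ fun b hb => ?_).trans
          (mul_le_mul_of_nonneg_right (Nat.cast_le.2 (hDcard (V s u))) hη)
        rw [freq_comp_equiv (V t) fun w => ¬ IsCaptured (wordProd S w) b (D w)]
        exact hD b (by rw [hDlen _ b hb]; omega)
    · refine freq_pi_apply_le (p := fun w => ¬ IsCaptured (wordProd S (V t w)) c₀ (D (V t w))) hη
        ?_ j
      rw [freq_comp_equiv (V t) fun w => ¬ IsCaptured (wordProd S w) c₀ (D w)]
      exact hD c₀ (by simp [c₀])
  obtain ⟨w, hw⟩ : ∃ w, ¬ ∃ p ∈ (Finset.univ : Finset (Fin 4 × Bool × Fin 4 × Bool)), bad p w := by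
    refine exists_not_of_freq_lt_one ((freq_exists_le_card_mul _ bad fun p _ => hbad p).trans_lt ?_)
    norm_num
  simp only [Finset.mem_univ, true_and, not_exists] at hw
  let Z (i : Fin 4) (s : Bool) : Set (CantorK n) := ⋃ b ∈ D (V s (w i)), cylinder b
  have hZ : ∀ i j, i ≠ j → ∀ s t, ∀ x ∈ Z i s, wordProd S (V t (w j)) • x ∈ Z j t := by
    intro i j hij s t x hx
    obtain ⟨b, hb, hxb⟩ := Set.mem_iUnion₂.1 hx
    have := (not_or.1 (hw (i, s, j, t))).1
    push Not at this
    obtain ⟨c, hc, hcx⟩ := this hij b hb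
    exact Set.mem_iUnion₂.2 ⟨c, hc, hcx x hxb⟩
  have hc₀ : ∀ j t, ∀ x ∈ cylinder c₀, wordProd S (V t (w j)) • x ∈ Z j t := by
    intro j t x hx
    obtain ⟨c, hc, hcx⟩ := not_not.1 (not_or.1 (hw (j, t, j, t))).2
    exact Set.mem_iUnion₂.2 ⟨c, hc, hcx x hx⟩
  obtain ⟨e, helen, he⟩ := exists_extension_notMem hn c₀ (8 * d)
    (Finset.univ.biUnion fun p : Fin 4 × Bool => D (V p.2 (w p.1))) (by
      refine (Finset.card_biUnion_le_card_mul _ _ d fun p _ => hDcard _).trans ?_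
      simp)
  let x₀ : CantorK n := prepend (c₀ ++ e) fun _ => ⟨0, by omega⟩
  have hx₀e : x₀ ∈ cylinder (c₀ ++ e) := ⟨_, rfl⟩
  have hx₀ : x₀ ∈ cylinder c₀ := cylinder_append_subset c₀ e hx₀e
  refine exists_injective_of_four_contractions (fun i => wordProd S (w i)) Z
    (fun i j hij s x hx => ⟨hZ i j hij s true x hx, ?_⟩) x₀
    (fun j => ⟨hc₀ j true x₀ hx₀, ?_⟩) fun i s hxZ => ?_
  · rw [← hV]
    exact hZ i j hij s false x hx
  · rw [← hV]
    exact hc₀ j false x₀ hx₀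
  · obtain ⟨b, hb, hxb⟩ := Set.mem_iUnion₂.1 hxZ
    have hne : b ≠ c₀ ++ e := by
      rintro rfl
      exact he (Finset.mem_biUnion.2 ⟨(i, s), Finset.mem_univ _, hb⟩)
    exact Set.disjoint_left.1 (disjoint_cylinder_of_length_eq
      (by rw [hDlen _ b hb, List.length_append, helen]; simp [c₀]) hne) hxb hx₀e

/-! ### The dichotomy and its application to Thompson's group. -/

/-- A finitely generated group acting on the Cantor set by prefix replacements has a finite orbit
or contains a free group of rank two. -/
theorem exists_finite_orbit_or_free {n : ℕ} (hn : 2 ≤ n) {G : Type*} [Group G] [Group.FG G]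
    [MulAction G (CantorK n)] (hG : ∀ g : G, PrefixReplacing (n := n) g) :
    (∃ y : CantorK n, (Set.range fun g : G => g • y).Finite) ∨
      ∃ φ : FreeGroup (Fin 2) →* G, Function.Injective φ := by
  classical
  obtain ⟨T, hT⟩ := Group.fg_def.1 (inferInstance : Group.FG G)
  -- The inverses make the walk symmetric; the identity is the reference element for almost
  -- invariance.
  let T' : Finset G := insert 1 (T ∪ T.image (·⁻¹))
  have hT'inv : ∀ g ∈ T', g⁻¹ ∈ T' := by
    intro g hg
    simp only [T', Finset.mem_insert, Finset.mem_union, Finset.mem_image] at hg ⊢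
    rcases hg with rfl | hg | ⟨k, hk, rfl⟩
    · simp
    · exact Or.inr (Or.inr ⟨g, hg, rfl⟩)
    · simp [hk]
  let S : T' → G := Subtype.val
  have hS : Subgroup.closure (Set.range S) = ⊤ := by
    refine top_le_iff.1 (hT.symm.trans_le (Subgroup.closure_mono fun g hg => ?_))
    exact ⟨⟨g, Finset.mem_insert_of_mem (Finset.mem_union_left _ hg)⟩, rfl⟩
  let σ : T' ≃ T' := Function.Involutive.toPerm (fun g => ⟨g.1⁻¹, hT'inv g.1 g.2⟩)
    fun g => Subtype.ext (inv_inv g.1)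
  have hσ : ∀ i, S (σ i) = (S i)⁻¹ := fun i => rfl
  let one : T' := ⟨1, Finset.mem_insert_self _ _⟩
  have : Nonempty T' := ⟨one⟩
  by_cases hm : Nonempty (InvariantMean G (CantorK n))
  · obtain ⟨m⟩ := hm
    exact Or.inl (m.exists_finite_orbit hG S hS fun i => ⟨σ i, hσ i⟩)
  · right
    -- The walk runs on self-maps of `K_n`, under postcomposition, so that the prefix maps `prepend
    -- b` are its points. Evaluation at a fixed end is equivariant and pushes a mean forward to
    -- `K_n`.
    have hm' : ¬ Nonempty (InvariantMean G (CantorK n → CantorK n)) := fun ⟨m⟩ =>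
      hm ⟨m.map (fun ω => ω fun _ => ⟨0, by omega⟩) fun _ _ => rfl⟩
    obtain ⟨ρ, h0, h1, hρ⟩ := exists_spectral_gap S hS one rfl hm'
    obtain ⟨L, hL⟩ := exists_uniform_prefix_bound S fun i => hG (S i)
    obtain ⟨η, d, hη, hd, hcap⟩ := exists_captures hL h0 h1
      (fun k x y => freq_wordProd_smul_eq_le S h0 hρ k x y) (ε := 1 / 100) (by norm_num)
    exact exists_free_of_captures hn S σ hσ hη hd hcap

/-- The tautological action of a group of homeomorphisms in Thompson's group on the Cantor set. -/
abbrev thompsonAction {n : ℕ} (Γ : Subgroup (ThompsonV n)) : MulAction Γ (CantorK n) where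
  smul g x := g.1.1 x
  one_smul _ := rfl
  mul_smul _ _ _ := rfl

/-- A long word passes through an endpoint of the domain tree and loses at most that endpoint, whose
length is at most `K`. -/
theorem prefixReplacing_thompson {n : ℕ} (Γ : Subgroup (ThompsonV n)) (g : Γ) :
    letI := thompsonAction Γ
    PrefixReplacing (n := n) g := by
  let := thompsonAction Γ
  obtain ⟨A, B, τ, h⟩ := g.1.2
  obtain ⟨L, hL⟩ := A.exists_prefix
  obtain ⟨K, hK⟩ := (A.endpoints_finite.image List.length).bddAbove
  refine ⟨L + K, fun b hb => ?_⟩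
  obtain ⟨a, ha, u, rfl⟩ := hL b (by omega)
  have haK : a.length ≤ K := hK ⟨a, ha, rfl⟩
  refine ⟨(τ ⟨a, ha⟩).1 ++ u, funext fun x => ?_, by simp only [List.length_append]; omega⟩
  change g.1.1 (prepend (a ++ u) x) = _
  rw [prepend_append, h ⟨a, ha⟩, prepend_append]

theorem theorem1p4 (n : ℕ) (hn : 2 ≤ n) (Γ : Subgroup (ThompsonV n)) (hΓ : Γ.FG) :
    (∃ p : CantorK n, {q : CantorK n | ∃ g ∈ Γ, g.1 p = q}.Finite) ∨
      (∃ φ : FreeGroup (Fin 2) →* Γ, Function.Injective φ) := by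
  let := thompsonAction Γ
  have : Group.FG Γ := (Group.fg_iff_subgroup_fg Γ).2 hΓ
  refine (exists_finite_orbit_or_free hn (prefixReplacing_thompson Γ)).imp_left ?_
  rintro ⟨p, hp⟩
  refine ⟨p, hp.subset ?_⟩
  rintro _ ⟨g, hg, rfl⟩
  exact ⟨⟨g, hg⟩, rfl⟩
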